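/- Fix $d\in\mathbb N$ and $\alpha\in(0,\infty)$. For a finite Borel measure $\nu$ on $\mathbb R^d$ with $$\nu(\{0\})=0,\qquad \int_{|x|\le2}|x|^2\,\nu(\mathrm dx)+\int_{|x|>2}(\log|x|)^\alpha\,\nu(\mathrm dx)<\infty, \qquad(*)$$ put $M_\alpha(B)=\int_{\mathbb R^d}\int_0^1 1_B(ry)(-\log r)^{\alpha-1}r^{-1}\,\mathrm dr\,\nu(\mathrm dy)$ for Borel $B\subseteq\mathbb R^d$, and for $\gamma\in\mathbb R^d$ let $L^*_\alpha(\nu,\gamma)$ be the infinitely divisible distribution with no Gaussian part, Lévy measure $M_\alpha$ (which satisfies $M_\alpha(\{0\})=0$ and $\int(|x|\wedge1)\,M_\alpha(\mathrm dx)<\infty$) and drift $\gamma$, that is, the distribution with characteristic function $z\mapsto\exp\{i\langle\gamma,z\rangle+\int_{\mathbb R^d}(e^{i\langle z,x\rangle}-1)\,M_\alpha(\mathrm dx)\}$. **Theorem.** Let $\nu$ be a finite nonzero Borel measure on $\mathbb R^d$ satisfying $(*)$, and set $\theta=\nu(\mathbb R^d)$, $\nu_1=\nu/\theta$. Let $E_1,E_2,\dots\sim\mathrm{Exp}(1)$,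 $V_1,V_2,\dots\sim U(0,1)$ and $Y_1,Y_2,\dots\sim\nu_1$ be iid sequences, independent of each other, and let $\Gamma_i=E_1+\cdots+E_i$. Fix $\gamma\in\mathbb R^d$ and $T>0$ and set $$X_t=t\gamma+\sum_{i=1}^\infty e^{-\left(\frac{\alpha\Gamma_i}{T\theta}\right)^{1/\alpha}}\,Y_i\,1_{[0,t/T]}(V_i),\qquad t\in[0,T].$$ Then, almost surely, the series converges uniformly in $t\in[0,T]$, and $\{X_t:0\le t\le T\}$ is a Lévy process (it starts at $0$ almost surely, has independent and stationary increments, is stochastically continuous, and has càdlàg paths almost surely) with $X_t\sim L^*_\alpha(t\nu,t\gamma)$ for every $t\in[0,T]$. When $\alpha=1$ we can write $$X_t=t\gamma+\sum_{i=1}^\infty (U_1U_2\cdots U_i)^{1/(T\theta)}\,Y_i\,1_{[0,t/T]}(V_i),\qquad t\in[0,T],$$ where $U_1,U_2,\dots$ are iid $U(0,1)$ and independent of the sequences of $Y_i$'s and $V_i$'s: this holds almost surely, for all $t\in[0,T]$, with $U_i=e^{-E_i}$; and for any iid $U(0,1)$ sequence $(U_i)$ independent of the sequences $(Y_i)$ and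 $(V_i)$, the series on the right-hand side converges almost surely uniformly on $[0,T]$ and defines a Lévy process on $[0,T]$ whose value at time $t$ has distribution $L^*_1(t\nu,t\gamma)$. -/

import Mathlib

open MeasureTheory ProbabilityTheory Filter Topology Set

noncomputable section

/-- The measure
`M_α(B) = ∫_{ℝᵈ} ∫₀¹ 1_B(r y) (-log r)^{α-1} r⁻¹ dr ν(dy)` (for a finite, or s-finite, `ν`),
written as the image of `ν(dy) ⊗ (-log r)^{α-1} r⁻¹ 1_{(0,1)}(r) dr` under `(y, r) ↦ r y`. -/
def radialMeasure {d : ℕ} (α : ℝ) (ν : Measure (EuclideanSpace ℝ (Fin d))) :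
    Measure (EuclideanSpace ℝ (Fin d)) :=
  (ν.prod ((volume.restrict (Ioo (0 : ℝ) 1)).withDensity
      (fun r => ENNReal.ofReal ((-Real.log r) ^ (α - 1) * r⁻¹)))).map
    (fun p => p.2 • p.1)

/-- The conditions `ν({0}) = 0` and
`∫_{|x| ≤ 2} |x|² ν(dx) + ∫_{|x| > 2} (log |x|)^α ν(dx) < ∞` on a background driving measure. -/
structure IsBackgroundMeasure {d : ℕ} (α : ℝ) (ν : Measure (EuclideanSpace ℝ (Fin d))) :
    Prop where
  zero_singleton : ν {0} = 0
  integral_lt_top :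
    (∫⁻ x in {x | ‖x‖ ≤ 2}, ENNReal.ofReal (‖x‖ ^ 2) ∂ν) +
      (∫⁻ x in {x | 2 < ‖x‖}, ENNReal.ofReal (Real.log ‖x‖ ^ α) ∂ν) < ⊤

/-- `μ = ID₀(M, γ)`: the infinitely divisible distribution `μ` of finite variation with Lévy
measure `M` (where `M({0}) = 0` and `∫ (|x| ∧ 1) M(dx) < ∞`) and drift `γ`, i.e. the probability
measure with characteristic function `exp (i⟨γ, z⟩ + ∫ (e^{i⟨z, x⟩} - 1) M(dx))`. -/
structure IsID0 {d : ℕ} (μ M : Measure (EuclideanSpace ℝ (Fin d)))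
    (γ : EuclideanSpace ℝ (Fin d)) : Prop where
  isProbabilityMeasure : IsProbabilityMeasure μ
  zero_singleton : M {0} = 0
  integral_lt_top : ∫⁻ x, ENNReal.ofReal (min ‖x‖ 1) ∂M < ⊤
  charFun_eq : ∀ z : EuclideanSpace ℝ (Fin d),
    charFun μ z = Complex.exp (Complex.I * (inner ℝ γ z : ℝ) +
      ∫ x, (Complex.exp (Complex.I * (inner ℝ z x : ℝ)) - 1) ∂M)

/-- `μ = L*_α(ν, γ)`: the distribution `ID₀(M_α, γ)`, where the background driving measure `ν`
is finite and satisfies the conditions of `IsBackgroundMeasure`. -/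
structure IsLStar {d : ℕ} (α : ℝ) (ν : Measure (EuclideanSpace ℝ (Fin d)))
    (γ : EuclideanSpace ℝ (Fin d)) (μ : Measure (EuclideanSpace ℝ (Fin d))) : Prop where
  isFiniteMeasure : IsFiniteMeasure ν
  isBackgroundMeasure : IsBackgroundMeasure α ν
  isID0 : IsID0 μ (radialMeasure α ν) γ

/-- The sequence `X` of random variables is iid with common distribution `μ`. -/
structure IsIID {Ω S : Type*} [MeasurableSpace Ω] [MeasurableSpace S]
    (X : ℕ → Ω → S) (μ : Measure S) (P : Measure Ω) : Prop where
  measurable : ∀ i, Measurable (X i)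
  map_eq : ∀ i, P.map (X i) = μ
  iIndepFun : iIndepFun X P

/-- The three sequences `A`, `B`, `C` of random variables are mutually independent (nothing is
said about the dependence inside each sequence). -/
structure IndepSequences {Ω S₁ S₂ S₃ : Type*} [MeasurableSpace Ω] [MeasurableSpace S₁]
    [MeasurableSpace S₂] [MeasurableSpace S₃]
    (A : ℕ → Ω → S₁) (B : ℕ → Ω → S₂) (C : ℕ → Ω → S₃) (P : Measure Ω) : Prop where
  indep_left : IndepFun (fun ω i => A i ω) (fun ω => ((fun i => B i ω), (fun i => C i ω))) P
  indep_right : IndepFun (fun ω i => B i ω) (fun ω i => C i ω) P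

/-- The uniform distribution on `(0, 1)`. -/
def uniformUnit : Measure ℝ := volume.restrict (Ioo (0 : ℝ) 1)

/-- The `i`-th term `W_i Y_i 1_{[0, t/T]}(V_i)` of a series with weights `W`. Sequences are indexed
from `0`. -/
def shotTerm {Ω : Type*} {d : ℕ} (T : ℝ) (W V : ℕ → Ω → ℝ)
    (Y : ℕ → Ω → EuclideanSpace ℝ (Fin d)) (t : ℝ) (ω : Ω) (i : ℕ) :
    EuclideanSpace ℝ (Fin d) :=
  (W i ω * (Icc 0 (t / T)).indicator (fun _ => (1 : ℝ)) (V i ω)) • Y i ω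

/-- The sum of the drift `t γ` and the first `n` terms of the series. -/
def shotPartial {Ω : Type*} {d : ℕ} (T : ℝ) (γ : EuclideanSpace ℝ (Fin d))
    (W V : ℕ → Ω → ℝ) (Y : ℕ → Ω → EuclideanSpace ℝ (Fin d)) (n : ℕ) (t : ℝ) (ω : Ω) :
    EuclideanSpace ℝ (Fin d) :=
  t • γ + ∑ i ∈ Finset.range n, shotTerm T W V Y t ω i

/-- `X_t = t γ + ∑_i W_i Y_i 1_{[0, t/T]}(V_i)`. -/
def shotNoise {Ω : Type*} {d : ℕ} (T : ℝ) (γ : EuclideanSpace ℝ (Fin d))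
    (W V : ℕ → Ω → ℝ) (Y : ℕ → Ω → EuclideanSpace ℝ (Fin d)) (t : ℝ) (ω : Ω) :
    EuclideanSpace ℝ (Fin d) :=
  t • γ + ∑' i, shotTerm T W V Y t ω i

/-- The weights `exp (-(α Γ_i / (T θ))^{1/α})` with `Γ_i` the sum of the `E_j` up to `j = i`. -/
def expWeight {Ω : Type*} (α T θ : ℝ) (E : ℕ → Ω → ℝ) (i : ℕ) (ω : Ω) : ℝ :=
  Real.exp (-((α * (∑ j ∈ Finset.range (i + 1), E j ω) / (T * θ)) ^ (1 / α)))

/-- The weights `(U_1 U_2 ⋯ U_i)^{1/(T θ)}`. -/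
def prodWeight {Ω : Type*} (T θ : ℝ) (U : ℕ → Ω → ℝ) (i : ℕ) (ω : Ω) : ℝ :=
  (∏ j ∈ Finset.range (i + 1), U j ω) ^ (1 / (T * θ))

/-- `{X_t : 0 ≤ t ≤ T}` is a Lévy process: it starts at `0` almost surely, has independent and
stationary increments, is stochastically continuous, and almost surely has càdlàg paths. -/
structure IsLevyProcessOn {Ω : Type*} [MeasurableSpace Ω] {d : ℕ} (T : ℝ)
    (X : ℝ → Ω → EuclideanSpace ℝ (Fin d)) (P : Measure Ω) : Prop where
  aemeasurable : ∀ t ∈ Icc 0 T, AEMeasurable (X t) P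
  start_zero : ∀ᵐ ω ∂P, X 0 ω = 0
  indep_increments : HasIndepIncrements (fun (t : Icc (0 : ℝ) T) => X t) P
  stationary_increments : ∀ s h : ℝ, 0 ≤ s → 0 ≤ h → s + h ≤ T →
    P.map (fun ω => X (s + h) ω - X s ω) = P.map (fun ω => X h ω - X 0 ω)
  stoch_continuous : ∀ t ∈ Icc 0 T, TendstoInMeasure P X (𝓝[Icc 0 T] t) (X t)
  cadlag : ∀ᵐ ω ∂P,
    (∀ t ∈ Ico 0 T, ContinuousWithinAt (fun s => X s ω) (Icc t T) t) ∧
    (∀ t ∈ Ioc 0 T, ∃ l, Tendsto (fun s => X s ω) (𝓝[Ico 0 t] t) (𝓝 l))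

/-- For almost every `ω` the partial sums converge to the sum of the series uniformly in
`t ∈ [0, T]`. -/
def ShotUniformlyConverges {Ω : Type*} [MeasurableSpace Ω] {d : ℕ} (T : ℝ)
    (γ : EuclideanSpace ℝ (Fin d)) (W V : ℕ → Ω → ℝ) (Y : ℕ → Ω → EuclideanSpace ℝ (Fin d))
    (P : Measure Ω) : Prop :=
  ∀ᵐ ω ∂P, TendstoUniformlyOn (fun n t => shotPartial T γ W V Y n t ω)
    (fun t => shotNoise T γ W V Y t ω) atTop (Icc 0 T)

end

/-! The points `Γ_i` with marks `(V_i, Y_i)` form a marked Poisson process on the half line, so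
everything reduces to computing its characteristic functional. No point process theory is used. For
`|f| ≤ 1` and `g` the average of `f` over the marks, put `h(x) = exp ∫_x^∞ (g - 1)`. The products of
`f(Γ_j, ξ_j)` over `j ≤ n`, times `h(Γ_n)`, have constant expectation `h(0)`; since `h → 1` at
infinity, dominated convergence gives Campbell's formula (`exists_harmonic_exp_tail`,
`integral_prod_mul_harmonic`, `integral_tendsto_prod_marked_poisson`).

The weight function carries Lebesgue measure on the half line to a multiple of the radial density
(`map_pointWeight`), which brings in `M_α`. Campbell's formula for a step function of the mark
yields the joint characteristic function of increments over disjoint intervals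
(`integral_exp_sum_inner_increments`). It factorises, and each factor depends only on the interval
length: independence, stationarity and the marginal laws all follow.

Convergence is pathwise: by the strong law `Γ_n / n → 1` and `(log⁺ |Y_n|)^α / n → 0`, so the terms
are eventually at most `exp(-K n^{1/α})` with `K > 0` (`summable_pointWeight_mul`). The resulting
norm bound is uniform in `t` and gives uniform convergence and càdlàg paths. -/

section IID

/-! ### Independent identically distributed sequences. -/

variable {Ω S S' : Type*} [MeasurableSpace Ω] [MeasurableSpace S] [MeasurableSpace S']
  {P : Measure Ω}

theorem IsIID.comp {X : ℕ → Ω → S} {μ : Measure S} (hX : IsIID X μ P) {f : S → S'}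
    (hf : Measurable f) : IsIID (fun i ω => f (X i ω)) (μ.map f) P where
  measurable i := hf.comp (hX.measurable i)
  map_eq i := by
    rw [← hX.map_eq i, Measure.map_map hf (hX.measurable i)]; rfl
  iIndepFun := hX.iIndepFun.comp (fun _ => f) (fun _ => hf)

/-- Measurable rectangles form a π-system generating the product σ-algebra, so independence only has
to be checked on them, where it splits into the independence of the two sequences and within each.
-/
theorem IsIID.prodMk [IsProbabilityMeasure P] {A : ℕ → Ω → S} {B : ℕ → Ω → S'} {μ : Measure S}
    {μ' : Measure S'} (hA : IsIID A μ P) (hB : IsIID B μ' P)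
    (hAB : IndepFun (fun ω i => A i ω) (fun ω i => B i ω) P) :
    IsIID (fun i ω => (A i ω, B i ω)) (μ.prod μ') P where
  measurable i := (hA.measurable i).prodMk (hB.measurable i)
  map_eq i := by
    have h : IndepFun (A i) (B i) P :=
      hAB.comp (measurable_pi_apply i) (measurable_pi_apply i)
    have := (indepFun_iff_map_prod_eq_prod_map_map (hA.measurable i).aemeasurable
      (hB.measurable i).aemeasurable).1 h
    rw [this, hA.map_eq, hB.map_eq]
  iIndepFun := by
    have hm : ∀ i, Measurable fun ω => (A i ω, B i ω) := fun i =>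
      (hA.measurable i).prodMk (hB.measurable i)
    rw [iIndepFun_iff_iIndep]
    refine iIndepSets.iIndep (fun i => (hm i).comap_le)
      (fun i => {s | ∃ t ∈ image2 (fun (a : Set S) (b : Set S') => a ×ˢ b)
        {a | MeasurableSet a} {b | MeasurableSet b}, (fun ω => (A i ω, B i ω)) ⁻¹' t = s})
      (fun i => isPiSystem_prod.comap _) (fun i => ?_) ?_
    · rw [← generateFrom_prod, MeasurableSpace.comap_generateFrom]; rfl
    · rw [iIndepSets_iff]
      intro s f hf
      choose! t ht hft using hf
      choose! a ha b hb hab using ht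
      have hP : ∀ i ∈ s, f i = A i ⁻¹' a i ∩ B i ⁻¹' b i := by
        intro i hi
        rw [← hft i hi, ← hab i hi]; rfl
      have hi1 : ∀ i ∈ s, P (f i) = P (A i ⁻¹' a i) * P (B i ⁻¹' b i) := by
        intro i hi
        rw [hP i hi]
        have h : IndepFun (A i) (B i) P :=
          hAB.comp (measurable_pi_apply i) (measurable_pi_apply i)
        exact h.measure_inter_preimage_eq_mul _ _ (ha i hi) (hb i hi)
      have e : ⋂ i ∈ s, f i = (fun ω i => A i ω) ⁻¹' (⋂ i ∈ s, (fun x => x i) ⁻¹' a i) ∩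
          (fun ω i => B i ω) ⁻¹' (⋂ i ∈ s, (fun x => x i) ⁻¹' b i) := by
        rw [iInter₂_congr hP]
        ext ω
        simp only [mem_iInter, mem_inter_iff, mem_preimage]
        exact ⟨fun h => ⟨fun i hi => (h i hi).1, fun i hi => (h i hi).2⟩,
          fun h i hi => ⟨h.1 i hi, h.2 i hi⟩⟩
      rw [e, hAB.measure_inter_preimage_eq_mul _ _
        (s.measurableSet_biInter fun i hi => measurable_pi_apply i (ha i hi))
        (s.measurableSet_biInter fun i hi => measurable_pi_apply i (hb i hi)),
        Finset.prod_congr rfl hi1, Finset.prod_mul_distrib]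
      simp only [preimage_iInter, ← preimage_comp]
      congr 1
      · exact hA.iIndepFun.measure_inter_preimage_eq_mul s ha
      · exact hB.iIndepFun.measure_inter_preimage_eq_mul s hb

theorem IsIID.indep_past {X : ℕ → Ω → S} {μ : Measure S} (hX : IsIID X μ P) {β : Type*}
    [MeasurableSpace β] {n : ℕ} {F : Ω → β}
    (hF : Measurable[⨆ i ∈ Iio n, MeasurableSpace.comap (X i) inferInstance] F) :
    IndepFun F (X n) P := by
  have h := indep_iSup_of_disjoint (fun i => (hX.measurable i).comap_le)
    ((iIndepFun_iff_iIndep _ _ _).1 hX.iIndepFun) (S := Iio n) (T := {n}) (by simp)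
  rw [IndepFun_iff_Indep]
  refine indep_of_indep_of_le_left (indep_of_indep_of_le_right h ?_) hF.comap_le
  exact le_iSup₂_of_le n rfl le_rfl

end IID

/-! ### The standard exponential law. -/

section Exponential

theorem expMeasure_one_eq :
    expMeasure 1 = (volume.restrict (Ioi (0 : ℝ))).withDensity
      (fun u => ENNReal.ofReal (Real.exp (-u))) := by
  rw [restrict_Ioi_eq_restrict_Ici, ← withDensity_indicator measurableSet_Ici]
  change volume.withDensity (exponentialPDF 1) = _
  congr 1
  ext u
  by_cases h : 0 ≤ u
  · simp [exponentialPDF_of_nonneg h, h]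
  · simp [exponentialPDF_of_neg (not_le.1 h), h]

theorem integral_expMeasure_one {F : Type*} [NormedAddCommGroup F] [NormedSpace ℝ F]
    (f : ℝ → F) :
    ∫ u, f u ∂(expMeasure 1) = ∫ u in Ioi (0 : ℝ), Real.exp (-u) • f u := by
  rw [expMeasure_one_eq, integral_withDensity_eq_integral_toReal_smul (by fun_prop) (by simp)]
  simp [(Real.exp_pos _).le]

theorem map_exp_neg_expMeasure_one :
    (expMeasure 1).map (fun u => Real.exp (-u)) = uniformUnit := by
  refine Measure.ext_of_lintegral _ fun f hf => ?_
  rw [lintegral_map hf (by fun_prop), expMeasure_one_eq,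
    lintegral_withDensity_eq_lintegral_mul _ (by fun_prop) (by fun_prop), uniformUnit]
  have himg : (fun u => Real.exp (-u)) '' Ioi 0 = Ioo 0 1 := by
    ext r
    constructor
    · rintro ⟨u, hu, rfl⟩
      exact ⟨Real.exp_pos _, by simpa using hu⟩
    · rintro ⟨h0, h1⟩
      exact ⟨-Real.log r, by simpa using Real.log_neg h0 h1, by simp [Real.exp_log h0]⟩
  rw [← himg, lintegral_image_eq_lintegral_abs_deriv_mul measurableSet_Ioi
    (f' := fun u => -Real.exp (-u)) (fun x _ => ?_) (fun x _ y _ h => by simpa using h)]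
  · simp [abs_of_pos, Real.exp_pos]
  · have := ((hasDerivAt_id x).neg.exp).hasDerivWithinAt (s := Ioi 0)
    simpa using this

end Exponential

/-! ### Campbell's formula for a marked Poisson process. -/

section Campbell

-- With `h(x) = exp ∫_x^∞ (g - 1)` one has `h' = -(g - 1) h`, so `-e^{-u} h(x + u)` is an
-- antiderivative of `e^{-u} g(x + u) h(x + u)`. This is the mean value property of `h` under one
-- exponential step.
open Complex in
theorem exists_harmonic_exp_tail {g : ℝ → ℂ} (hg : Continuous g) (hg1 : ∀ x, ‖g x‖ ≤ 1)
    (hint : IntegrableOn (fun x => g x - 1) (Ioi 0)) :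
    ∃ h : ℝ → ℂ, Continuous h ∧ (∀ x, ‖h x‖ ≤ 1) ∧ Tendsto h atTop (𝓝 1) ∧
      h 0 = Complex.exp (∫ x in Ioi 0, (g x - 1)) ∧
      ∀ x, ∫ u, g (x + u) * h (x + u) ∂(expMeasure 1) = h x := by
  -- The tail integral, written as a difference so that it is differentiable on all of `ℝ`.
  set k : ℝ → ℂ := fun x => (∫ y in Ioi 0, (g y - 1)) - ∫ y in (0 : ℝ)..x, (g y - 1) with hk
  have hgc : Continuous fun y => g y - 1 := hg.sub continuous_const
  have hkd : ∀ x, HasDerivAt k (-(g x - 1)) x := fun x => by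
    have := (hgc.integral_hasStrictDerivAt 0 x).hasDerivAt
    exact this.const_sub _
  have hkt : Tendsto k atTop (𝓝 0) := by
    have := intervalIntegral_tendsto_integral_Ioi 0 hint tendsto_id
    simpa [hk] using this.const_sub (∫ y in Ioi 0, (g y - 1))
  -- As `Re g ≤ 1`, the real part of `k` is nondecreasing; its limit at infinity is `0`. Hence `|exp
  -- k| ≤ 1`.
  have hkre : ∀ x, (k x).re ≤ 0 := by
    have hd : ∀ x, HasDerivAt (fun x => (k x).re) (-(g x - 1)).re x := fun x =>
      Complex.reCLM.hasFDerivAt.comp_hasDerivAt x (hkd x)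
    have hmono : Monotone fun x => (k x).re := by
      refine monotone_of_deriv_nonneg (fun x => (hd x).differentiableAt) fun x => ?_
      rw [(hd x).deriv]
      have := (Complex.re_le_norm (g x)).trans (hg1 x)
      simp only [neg_re, sub_re, one_re]
      linarith
    have ht : Tendsto (fun x => (k x).re) atTop (𝓝 0) := by
      exact (Complex.continuous_re.tendsto 0).comp hkt
    exact fun x => hmono.ge_of_tendsto ht x
  have hhd : ∀ x, HasDerivAt (fun x => exp (k x)) (exp (k x) * -(g x - 1)) x := fun x =>
    (hkd x).cexp
  have hhc : Continuous fun x => exp (k x) :=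
    continuous_iff_continuousAt.2 fun x => (hhd x).continuousAt
  have hhn : ∀ x, ‖exp (k x)‖ ≤ 1 := fun x => by
    rw [Complex.norm_exp]; exact Real.exp_le_one_iff.2 (hkre x)
  refine ⟨fun x => exp (k x), hhc, hhn, by simpa using hkt.cexp, by simp [hk], fun x => ?_⟩
  rw [integral_expMeasure_one]
  have hF : ∀ u, HasDerivAt (fun u : ℝ => -(Real.exp (-u) • exp (k (x + u))))
      (Real.exp (-u) • (g (x + u) * exp (k (x + u)))) u := fun u => by
    have h1 : HasDerivAt (fun u : ℝ => Real.exp (-u)) (Real.exp (-u) * -1) u :=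
      (hasDerivAt_id u).neg.exp
    have h2 : HasDerivAt (fun u : ℝ => exp (k (x + u)))
        (exp (k (x + u)) * -(g (x + u) - 1)) u := by
      simpa using HasDerivAt.comp_const_add x u (hhd (x + u))
    refine (h1.smul h2).neg.congr_deriv ?_
    simp only [real_smul]
    push_cast
    ring
  have hexp : IntegrableOn (fun u : ℝ => Real.exp (-u)) (Ioi 0) := by
    simpa using integrableOn_exp_neg_Ioi 0
  have := integral_Ioi_of_hasDerivAt_of_tendsto' (a := 0) (m := 0) (fun u _ => hF u) ?_ ?_
  · rw [this]; simp
  · refine Integrable.mono' hexp (by fun_prop) (ae_of_all _ fun u => ?_)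
    rw [norm_smul, norm_mul, Real.norm_of_nonneg (Real.exp_pos _).le]
    exact mul_le_of_le_one_right (Real.exp_pos _).le
      (mul_le_one₀ (hg1 _) (norm_nonneg _) (hhn _))
  · rw [tendsto_zero_iff_norm_tendsto_zero]
    refine squeeze_zero (fun _ => norm_nonneg _) (fun u => ?_)
      (Real.tendsto_exp_neg_atTop_nhds_zero)
    rw [norm_neg, norm_smul, Real.norm_of_nonneg (Real.exp_pos _).le]
    exact mul_le_of_le_one_right (Real.exp_pos _).le (hhn _)

variable {Ω S : Type*} [MeasurableSpace Ω] [MeasurableSpace S] {P : Measure Ω}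

/-- A martingale identity in expectation: the step from `n` to `n + 1` integrates out the pair `Z
n`, independent of the past, and the harmonicity of `h` absorbs the new factor. -/
theorem integral_prod_mul_harmonic [IsProbabilityMeasure P] {μ : Measure S}
    [IsProbabilityMeasure μ] {Z : ℕ → Ω → ℝ × S} (hZ : IsIID Z ((expMeasure 1).prod μ) P)
    {f : ℝ × S → ℂ} (hf : Measurable f) (hf1 : ∀ x, ‖f x‖ ≤ 1) {h : ℝ → ℂ} (hh : Continuous h)
    (hh1 : ∀ x, ‖h x‖ ≤ 1)
    (harm : ∀ x, ∫ u, (∫ s, f (x + u, s) ∂μ) * h (x + u) ∂(expMeasure 1) = h x) (n : ℕ) :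
    ∫ ω, (∏ j ∈ Finset.range n, f (∑ i ∈ Finset.range (j + 1), (Z i ω).1, (Z j ω).2)) *
      h (∑ i ∈ Finset.range n, (Z i ω).1) ∂P = h 0 := by
  have : IsProbabilityMeasure (expMeasure 1) := isProbabilityMeasure_expMeasure one_pos
  induction n with
  | zero => simp
  | succ n ih =>
    -- The past enters only through the partial product and the current point `Γ_n`.
    set A : Ω → ℂ × ℝ := fun ω =>
      (∏ j ∈ Finset.range n, f (∑ i ∈ Finset.range (j + 1), (Z i ω).1, (Z j ω).2),
        ∑ i ∈ Finset.range n, (Z i ω).1) with hA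
    have hAm : Measurable[⨆ i ∈ Iio n, MeasurableSpace.comap (Z i) inferInstance] A := by
      have hZi : ∀ i < n,
          Measurable[⨆ i ∈ Iio n, MeasurableSpace.comap (Z i) inferInstance] (Z i) :=
        fun i hi => (comap_measurable (Z i)).mono
          (le_iSup₂_of_le (f := fun i (_ : i ∈ Iio n) =>
            MeasurableSpace.comap (Z i) inferInstance) i hi le_rfl) le_rfl
      refine Measurable.prodMk (Finset.measurable_prod _ fun j hj => hf.comp
        (Measurable.prodMk (Finset.measurable_sum _ fun i hi => ?_) ?_))
        (Finset.measurable_sum _ fun i hi => ?_)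
      · exact measurable_fst.comp (hZi i (by simp at hi hj; omega))
      · exact measurable_snd.comp (hZi j (by simpa using hj))
      · exact measurable_fst.comp (hZi i (by simpa using hi))
    have hAm' : Measurable A := hAm.mono (iSup₂_le fun i _ => (hZ.measurable i).comap_le) le_rfl
    have hind := (indepFun_iff_map_prod_eq_prod_map_map hAm'.aemeasurable
      (hZ.measurable n).aemeasurable).1 (hZ.indep_past hAm)
    rw [hZ.map_eq] at hind
    have : IsProbabilityMeasure (P.map A) := Measure.isProbabilityMeasure_map hAm'.aemeasurable
    set G : (ℂ × ℝ) × (ℝ × S) → ℂ := fun p =>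
      p.1.1 * (f (p.1.2 + p.2.1, p.2.2) * h (p.1.2 + p.2.1)) with hG
    have hGm : Measurable G := by
      have := hh.measurable
      fun_prop
    have hAn : ∀ ω, ‖(A ω).1‖ ≤ 1 := fun ω => by
      simp only [hA, norm_prod]
      exact Finset.prod_le_one (fun _ _ => norm_nonneg _) fun _ _ => hf1 _
    have hGi : Integrable G ((P.map A).prod ((expMeasure 1).prod μ)) := by
      rw [← hind, integrable_map_measure hGm.aestronglyMeasurable
        (hAm'.prodMk (hZ.measurable n)).aemeasurable]
      refine Integrable.of_bound (hGm.comp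
        (hAm'.prodMk (hZ.measurable n))).aestronglyMeasurable 1 (ae_of_all _ fun ω => ?_)
      simp only [hG, Function.comp, norm_mul]
      exact mul_le_one₀ (hAn ω) (by positivity) (mul_le_one₀ (hf1 _) (norm_nonneg _) (hh1 _))
    have e1 : ∫ ω, (∏ j ∈ Finset.range (n + 1),
        f (∑ i ∈ Finset.range (j + 1), (Z i ω).1, (Z j ω).2)) *
        h (∑ i ∈ Finset.range (n + 1), (Z i ω).1) ∂P = ∫ ω, G (A ω, Z n ω) ∂P := by
      congr 1; ext ω
      simp only [hG, hA, Finset.prod_range_succ, Finset.sum_range_succ]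
      ring
    have e2 : ∫ ω, G (A ω, Z n ω) ∂P = ∫ p, G p ∂((P.map A).prod ((expMeasure 1).prod μ)) := by
      rw [← hind, integral_map (hAm'.prodMk (hZ.measurable n)).aemeasurable
        hGm.aestronglyMeasurable]
    have e3 : ∀ a : ℂ × ℝ, ∫ q, G (a, q) ∂((expMeasure 1).prod μ) = a.1 * h a.2 := fun a => by
      simp only [hG]
      rw [integral_const_mul, ← harm a.2, integral_prod]
      · simp only [integral_mul_const]
      · refine Integrable.of_bound ?_ 1 (ae_of_all _ fun q => ?_)
        · have := hh.measurable
          exact Measurable.aestronglyMeasurable (by fun_prop)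
        · rw [norm_mul]
          exact mul_le_one₀ (hf1 _) (norm_nonneg _) (hh1 _)
    rw [e1, e2, integral_prod _ hGi]
    simp only [e3]
    rw [integral_map hAm'.aemeasurable, ← ih]
    have := hh.measurable
    exact Measurable.aestronglyMeasurable (by fun_prop)

/-- A version of Campbell's formula for the marked Poisson process with points `Γ_j` and
marks `ξ_j`. -/
theorem integral_tendsto_prod_marked_poisson [IsProbabilityMeasure P] {μ : Measure S}
    [IsProbabilityMeasure μ] {Z : ℕ → Ω → ℝ × S} (hZ : IsIID Z ((expMeasure 1).prod μ) P)
    (hΓ : ∀ᵐ ω ∂P, Tendsto (fun n => ∑ i ∈ Finset.range n, (Z i ω).1) atTop atTop)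
    {f : ℝ × S → ℂ} (hf : Measurable f) (hf1 : ∀ x, ‖f x‖ ≤ 1)
    (hg : Continuous fun x => ∫ s, f (x, s) ∂μ)
    (hint : IntegrableOn (fun x => (∫ s, f (x, s) ∂μ) - 1) (Ioi 0)) {F : Ω → ℂ}
    (hF : ∀ᵐ ω ∂P, Tendsto (fun n => ∏ j ∈ Finset.range n,
      f (∑ i ∈ Finset.range (j + 1), (Z i ω).1, (Z j ω).2)) atTop (𝓝 (F ω))) :
    ∫ ω, F ω ∂P = Complex.exp (∫ x in Ioi (0 : ℝ), ((∫ s, f (x, s) ∂μ) - 1)) := by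
  obtain ⟨h, hh, hh1, hht, hh0, harm⟩ := exists_harmonic_exp_tail hg (fun x => by
    refine (norm_integral_le_of_norm_le_const (ae_of_all _ fun s => hf1 (x, s))).trans ?_
    simp) hint
  have hmart := integral_prod_mul_harmonic hZ hf hf1 hh hh1 harm
  have hZ1 : ∀ i, Measurable fun ω => (Z i ω).1 := fun i => measurable_fst.comp (hZ.measurable i)
  have hZ2 : ∀ i, Measurable fun ω => (Z i ω).2 := fun i => measurable_snd.comp (hZ.measurable i)
  -- All integrands are bounded by `1`, and `h(Γ_n) → 1` because `Γ_n → ∞`.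
  have hlim := tendsto_integral_of_dominated_convergence (μ := P) (fun _ => (1 : ℝ))
    (F := fun n ω => (∏ j ∈ Finset.range n,
      f (∑ i ∈ Finset.range (j + 1), (Z i ω).1, (Z j ω).2)) *
      h (∑ i ∈ Finset.range n, (Z i ω).1)) (f := F) (fun n => ?_) (integrable_const _)
      (fun n => ae_of_all _ fun ω => ?_) ?_
  · simp only [hmart] at hlim
    rw [← hh0]
    exact tendsto_nhds_unique hlim tendsto_const_nhds
  · have := hh.measurable
    refine Measurable.aestronglyMeasurable ?_
    fun_prop
  · rw [norm_mul, norm_prod]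
    exact mul_le_one₀ (Finset.prod_le_one (fun _ _ => norm_nonneg _) fun _ _ => hf1 _)
      (norm_nonneg _) (hh1 _)
  · filter_upwards [hΓ, hF] with ω h1 h2
    simpa using h2.mul (hht.comp h1)

end Campbell

/-! ### Stretched exponentials. -/

section ExpRpow

theorem summable_exp_neg_mul_rpow {a p : ℝ} (ha : 0 < a) (hp : 0 < p) :
    Summable fun n : ℕ => Real.exp (-(a * (n : ℝ) ^ p)) := by
  -- The exponent `-2 / p` becomes `-2` after substituting `n ^ p`.
  have h1 := (isLittleO_exp_neg_mul_rpow_atTop ha (-2 / p)).isBigO.comp_tendsto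
    ((tendsto_rpow_atTop hp).comp tendsto_natCast_atTop_atTop)
  have h2 : Summable fun n : ℕ => (n : ℝ) ^ (-2 : ℝ) := Real.summable_nat_rpow.2 (by norm_num)
  refine summable_of_isBigO_nat h2 ?_
  refine (h1.congr_left fun n => ?_).congr_right fun n => ?_
  · simp
  · simp only [Function.comp]
    rw [← Real.rpow_mul (Nat.cast_nonneg n), mul_div_cancel₀ _ hp.ne']

theorem integrableOn_exp_neg_mul_rpow {a p : ℝ} (ha : 0 < a) (hp : 0 < p) :
    IntegrableOn (fun x => Real.exp (-(a * x ^ p))) (Ioi 0) := by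
  have := AntitoneOn.integrableOn_Ioi_of_summable_comp_add (N := 0)
    (f := fun x => Real.exp (-(a * x ^ p))) ?_ (by simpa using summable_exp_neg_mul_rpow ha hp)
    fun _ _ => (Real.exp_pos _).le
  · simpa using this
  · intro x hx y hy hxy
    have : x ^ p ≤ y ^ p := Real.rpow_le_rpow (by simpa using hx) hxy hp.le
    simp only [Real.exp_le_exp, neg_le_neg_iff]
    gcongr

end ExpRpow

/-- The weight `exp (-(α s / c)^{1/α})` of a point `s` of a Poisson process. -/
noncomputable def pointWeight (α c s : ℝ) : ℝ := Real.exp (-((α * s / c) ^ (1 / α)))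

/-! ### The weight function and the radial density. -/

section PointWeight

variable {α c : ℝ}

theorem continuous_pointWeight (hα : 0 < α) : Continuous (pointWeight α c) := by
  unfold pointWeight
  refine Real.continuous_exp.comp (Continuous.neg ?_)
  exact (by fun_prop : Continuous fun s => α * s / c).rpow_const fun _ => Or.inr (by positivity)

theorem pointWeight_pos (s : ℝ) : 0 < pointWeight α c s := Real.exp_pos _

/-- The measure `(-log r)^{α-1} r⁻¹ dr` on `(0, 1)`. -/
noncomputable def radialDensity (α : ℝ) : Measure ℝ :=
  (volume.restrict (Ioo (0 : ℝ) 1)).withDensity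
    (fun r => ENNReal.ofReal ((-Real.log r) ^ (α - 1) * r⁻¹))

instance : SFinite (radialDensity α) := by unfold radialDensity; infer_instance

/-- The inverse of the weight function is `r ↦ c (-log r)^α / α`, whose derivative has absolute
value `c (-log r)^{α-1} r⁻¹`. -/
theorem map_pointWeight (hα : 0 < α) (hc : 0 < c) :
    (volume.restrict (Ioi 0)).map (pointWeight α c) = ENNReal.ofReal c • radialDensity α := by
  have hwm := (continuous_pointWeight (c := c) hα).measurable
  refine Measure.ext_of_lintegral _ fun f hf => ?_
  rw [lintegral_map hf hwm, lintegral_smul_measure, radialDensity,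
    lintegral_withDensity_eq_lintegral_mul _ (by fun_prop) hf, smul_eq_mul,
    ← lintegral_const_mul _ (by fun_prop)]
  have hneg : ∀ r ∈ Ioo (0 : ℝ) 1, 0 < -Real.log r := fun r hr => by
    simpa using Real.log_neg hr.1 hr.2
  have hinv : ∀ r ∈ Ioo (0 : ℝ) 1, pointWeight α c (c * (-Real.log r) ^ α / α) = r := by
    intro r hr
    unfold pointWeight
    rw [mul_div_cancel₀ _ hα.ne', mul_div_cancel_left₀ _ hc.ne', one_div,
      Real.rpow_rpow_inv (hneg r hr).le hα.ne', neg_neg, Real.exp_log hr.1]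
  have himg : (fun r => c * (-Real.log r) ^ α / α) '' Ioo 0 1 = Ioi 0 := by
    ext s
    constructor
    · rintro ⟨r, hr, rfl⟩
      have := hneg r hr
      exact mem_Ioi.2 (by positivity)
    · intro hs
      have hs' : 0 < (α * s / c) ^ (1 / α) := by
        have : 0 < s := hs
        positivity
      refine ⟨Real.exp (-((α * s / c) ^ (1 / α))), ⟨Real.exp_pos _, by simpa using hs'⟩, ?_⟩
      simp only [Real.log_exp, neg_neg, one_div]
      rw [Real.rpow_inv_rpow (by have : 0 < s := hs; positivity) hα.ne']
      field_simp
  rw [← himg, lintegral_image_eq_lintegral_abs_deriv_mul measurableSet_Ioo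
    (f' := fun r => c * (-r⁻¹ * α * (-Real.log r) ^ (α - 1)) / α) (fun r hr => ?_)
    (fun x hx y hy h => ?_)]
  · refine setLIntegral_congr_fun measurableSet_Ioo fun r hr => ?_
    have h1 := hneg r hr
    have h2 : 0 < r⁻¹ := inv_pos.2 hr.1
    have h3 : |c * (-r⁻¹ * α * (-Real.log r) ^ (α - 1)) / α| =
        c * ((-Real.log r) ^ (α - 1) * r⁻¹) := by
      have : c * (-r⁻¹ * α * (-Real.log r) ^ (α - 1)) / α =
          -(c * ((-Real.log r) ^ (α - 1) * r⁻¹)) := by field_simp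
      rw [this, abs_neg, abs_of_pos (by positivity)]
    simp only [Pi.mul_apply]
    rw [hinv r hr, h3, ENNReal.ofReal_mul hc.le, mul_assoc]
  · have h1 := hneg r hr
    exact ((((Real.hasDerivAt_log hr.1.ne').neg.rpow_const (Or.inl h1.ne')).const_mul
      c).div_const α).hasDerivWithinAt
  · rw [← hinv x hx, ← hinv y hy]
    exact congrArg _ h

end PointWeight

/-! ### The Lévy measure `M_α` and its integrability. -/

section RadialMeasure

variable {d : ℕ} {α c : ℝ} {ν : Measure (EuclideanSpace ℝ (Fin d))}

theorem smul_radialMeasure_eq_map [SFinite ν] (hα : 0 < α) (hc : 0 < c) :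
    ENNReal.ofReal c • radialMeasure α ν =
      (ν.prod (volume.restrict (Ioi 0))).map (fun p => pointWeight α c p.2 • p.1) := by
  have hwm := (continuous_pointWeight (c := c) hα).measurable
  change ENNReal.ofReal c • (ν.prod (radialDensity α)).map (fun p => p.2 • p.1) = _
  rw [← Measure.map_smul, ← Measure.prod_smul_right, ← map_pointWeight hα hc]
  conv_lhs => rw [← Measure.map_id (μ := ν), Measure.map_prod_map _ _ measurable_id hwm]
  rw [Measure.map_map (by fun_prop) (by fun_prop)]
  rfl

theorem radialMeasure_smul_measure (a : ENNReal) :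
    radialMeasure α (a • ν) = a • radialMeasure α ν := by
  simp only [radialMeasure]
  rw [Measure.prod_smul_left, Measure.map_smul]

theorem radialMeasure_singleton_zero [SFinite ν] (hν : ν {0} = 0) :
    radialMeasure α ν {0} = 0 := by
  change (ν.prod (radialDensity α)).map (fun p => p.2 • p.1) {0} = 0
  rw [Measure.map_apply (by fun_prop) (measurableSet_singleton 0)]
  have hr : ∀ᵐ r ∂(radialDensity α), r ≠ 0 := by
    have h : ∀ᵐ r ∂(volume.restrict (Ioo (0 : ℝ) 1)), r ≠ 0 := by
      filter_upwards [ae_restrict_mem measurableSet_Ioo] with r hr using hr.1.ne'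
    exact (withDensity_absolutelyContinuous _ _).ae_le h
  have hy : ∀ᵐ y ∂ν, y ≠ 0 := by
    rw [ae_iff]; simpa using hν
  have h1 : ∀ᵐ p ∂(ν.prod (radialDensity α)), p.1 ≠ 0 := Measure.quasiMeasurePreserving_fst.ae hy
  have h2 : ∀ᵐ p ∂(ν.prod (radialDensity α)), p.2 ≠ 0 := Measure.quasiMeasurePreserving_snd.ae hr
  have : ∀ᵐ p ∂(ν.prod (radialDensity α)), p.2 • p.1 ≠ 0 := by
    filter_upwards [h1, h2] with p hp1 hp2 using smul_ne_zero hp2 hp1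
  rw [ae_iff] at this
  simpa only [not_not, preimage, mem_singleton_iff, ne_eq] using this

open Real in
theorem IsBackgroundMeasure.lintegral_posLog_rpow_lt_top [IsFiniteMeasure ν] (hα : 0 < α)
    (hν : IsBackgroundMeasure α ν) : ∫⁻ y, ENNReal.ofReal (log⁺ ‖y‖ ^ α) ∂ν < ⊤ := by
  have hm : MeasurableSet {x : EuclideanSpace ℝ (Fin d) | ‖x‖ ≤ 2} :=
    measurableSet_le measurable_norm measurable_const
  rw [← lintegral_add_compl _ hm]
  refine ENNReal.add_lt_top.2 ⟨?_, ?_⟩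
  · calc ∫⁻ y in {x | ‖x‖ ≤ 2}, ENNReal.ofReal (log⁺ ‖y‖ ^ α) ∂ν
        ≤ ∫⁻ y in {x | ‖x‖ ≤ 2}, ENNReal.ofReal (log⁺ 2 ^ α) ∂ν := by
          refine setLIntegral_mono (by fun_prop) fun y hy => ENNReal.ofReal_le_ofReal ?_
          exact Real.rpow_le_rpow posLog_nonneg (posLog_le_posLog (norm_nonneg y) hy) hα.le
      _ < ⊤ := by
          rw [lintegral_const]
          exact ENNReal.mul_lt_top ENNReal.ofReal_lt_top (measure_lt_top _ _)
  · have he : {x : EuclideanSpace ℝ (Fin d) | ‖x‖ ≤ 2}ᶜ = {x | 2 < ‖x‖} := by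
      ext; simp
    rw [he]
    refine lt_of_eq_of_lt (setLIntegral_congr_fun (he ▸ hm.compl) fun y hy => ?_)
      (ENNReal.add_lt_top.1 hν.integral_lt_top).2
    have hy' : (2 : ℝ) < ‖y‖ := hy
    rw [posLog_eq_log (by rw [abs_of_nonneg (norm_nonneg y)]; linarith)]

-- Up to a threshold `s₀` the integrand is bounded by `1`, which costs `s₀`. Beyond it half of the
-- exponent beats `log⁺ y`, and the other half leaves an integrable bound independent of `y`.
open Real in
theorem lintegral_min_pointWeight_le (hα : 0 < α) :
    ∃ C : ENNReal, C < ⊤ ∧ ∀ y : ℝ, 0 ≤ y →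
      ∫⁻ s in Ioi (0 : ℝ), ENNReal.ofReal (min (pointWeight α 1 s * y) 1) ≤
        ENNReal.ofReal ((2 * log⁺ y) ^ α / α) + C := by
  have hint := integrableOn_exp_neg_mul_rpow (a := α ^ (1 / α) / 2) (p := 1 / α)
    (by positivity) (by positivity)
  refine ⟨_, hint.lintegral_lt_top, fun y hy => ?_⟩
  -- The solution of `(α s)^{1/α} = 2 log⁺ y`.
  set s₀ := (2 * log⁺ y) ^ α / α with hs₀
  have hL : 0 ≤ log⁺ y := posLog_nonneg
  have hyL : y ≤ exp (log⁺ y) := by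
    rw [posLog_eq_log_max_one hy, exp_log (by positivity)]
    exact le_max_right _ _
  calc ∫⁻ s in Ioi (0 : ℝ), ENNReal.ofReal (min (pointWeight α 1 s * y) 1)
      ≤ ∫⁻ s in Ioi (0 : ℝ), ((Ioc 0 s₀).indicator (fun _ => 1) s +
          ENNReal.ofReal (exp (-(α ^ (1 / α) / 2 * s ^ (1 / α))))) := by
        refine setLIntegral_mono ((measurable_const.indicator measurableSet_Ioc).add
          (by fun_prop)) fun s hs => ?_
        have hs' : 0 < s := hs
        by_cases h : s ≤ s₀
        · rw [indicator_of_mem (show s ∈ Ioc 0 s₀ from ⟨hs', h⟩)]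
          exact le_add_right (ENNReal.ofReal_le_one.2 (min_le_right _ _))
        · rw [indicator_of_notMem (fun h' => h h'.2), zero_add]
          refine ENNReal.ofReal_le_ofReal ((min_le_left _ _).trans ?_)
          have h1 : 2 * log⁺ y ≤ (α * s) ^ (1 / α) := by
            rw [one_div, Real.le_rpow_inv_iff_of_pos (by positivity) (by positivity) hα]
            have := (not_le.1 h).le
            rw [hs₀, div_le_iff₀ hα] at this
            linarith
          have h2 : (α * s) ^ (1 / α) = α ^ (1 / α) * s ^ (1 / α) :=
            Real.mul_rpow hα.le hs'.le
          calc pointWeight α 1 s * y ≤ exp (-((α * s) ^ (1 / α))) * exp (log⁺ y) := by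
                unfold pointWeight
                rw [div_one]
                gcongr
            _ = exp (-((α * s) ^ (1 / α)) + log⁺ y) := (exp_add _ _).symm
            _ ≤ _ := by
                rw [exp_le_exp, div_mul_eq_mul_div, ← h2]
                linarith
    _ = (∫⁻ s in Ioi (0 : ℝ), (Ioc 0 s₀).indicator (fun _ => 1) s) + _ :=
        lintegral_add_left (measurable_const.indicator measurableSet_Ioc) _
    _ ≤ _ := by
        gcongr
        rw [lintegral_indicator measurableSet_Ioc]
        refine (lintegral_mono' (Measure.restrict_mono_measure Measure.restrict_le_self _)
          le_rfl).trans ?_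
        simp

theorem lintegral_min_norm_radialMeasure_lt_top [IsFiniteMeasure ν] (hα : 0 < α)
    (hν : IsBackgroundMeasure α ν) :
    ∫⁻ x, ENNReal.ofReal (min ‖x‖ 1) ∂(radialMeasure α ν) < ⊤ := by
  have hwm := (continuous_pointWeight (c := 1) hα).measurable
  have h1 : radialMeasure α ν = (ν.prod (volume.restrict (Ioi 0))).map
      (fun p => pointWeight α 1 p.2 • p.1) := by
    simpa using smul_radialMeasure_eq_map (ν := ν) hα one_pos
  obtain ⟨C, hC, hb⟩ := lintegral_min_pointWeight_le hα
  rw [h1, lintegral_map (by fun_prop) (by fun_prop), lintegral_prod _ (by fun_prop)]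
  calc ∫⁻ y : EuclideanSpace ℝ (Fin d), (∫⁻ s in Ioi (0 : ℝ),
        ENNReal.ofReal (min ‖pointWeight α 1 s • y‖ 1)) ∂ν
      ≤ ∫⁻ y, (ENNReal.ofReal (2 ^ α / α) * ENNReal.ofReal (Real.posLog ‖y‖ ^ α) + C) ∂ν := by
        refine lintegral_mono fun y => ?_
        simp only [norm_smul, Real.norm_of_nonneg (pointWeight_pos _).le]
        refine (hb ‖y‖ (norm_nonneg y)).trans_eq ?_
        rw [← ENNReal.ofReal_mul (by positivity),
          Real.mul_rpow two_pos.le Real.posLog_nonneg]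
        congr 2
        ring
    _ < ⊤ := by
        rw [lintegral_add_right _ measurable_const, lintegral_const,
          lintegral_const_mul _ (by fun_prop)]
        exact ENNReal.add_lt_top.2 ⟨ENNReal.mul_lt_top ENNReal.ofReal_lt_top
          (hν.lintegral_posLog_rpow_lt_top hα), ENNReal.mul_lt_top hC (measure_lt_top _ _)⟩

end RadialMeasure

/-! ### Strong law of large numbers and convergence of the series. -/

section StrongLaw

variable {Ω : Type*} [MeasurableSpace Ω] {P : Measure Ω}

theorem IsIID.ae_tendsto_average {X : ℕ → Ω → ℝ} {μ : Measure ℝ} (hX : IsIID X μ P)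
    (hμ : Integrable id μ) :
    ∀ᵐ ω ∂P, Tendsto (fun n : ℕ => (∑ i ∈ Finset.range n, X i ω) / n) atTop
      (𝓝 (∫ x, x ∂μ)) := by
  have h := strong_law_ae_real X ?_ (fun i j hij => hX.iIndepFun.indepFun hij) fun i =>
    ⟨(hX.measurable i).aemeasurable, (hX.measurable 0).aemeasurable, by
      rw [hX.map_eq, hX.map_eq]⟩
  · rwa [← hX.map_eq 0, integral_map (hX.measurable 0).aemeasurable (by fun_prop)]
  · rw [← hX.map_eq 0, integrable_map_measure (by fun_prop) (hX.measurable 0).aemeasurable] at hμ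
    exact hμ

/-- `x n` is the difference of consecutive partial sums, and both of these divided by `n` tend to
`m`. -/
theorem tendsto_div_of_tendsto_average {x : ℕ → ℝ} {m : ℝ}
    (h : Tendsto (fun n : ℕ => (∑ i ∈ Finset.range n, x i) / n) atTop (𝓝 m)) :
    Tendsto (fun n : ℕ => x n / n) atTop (𝓝 0) := by
  have h1 : Tendsto (fun n : ℕ => ((n + 1 : ℕ) : ℝ) / n) atTop (𝓝 1) := by
    have : Tendsto (fun n : ℕ => 1 + 1 / (n : ℝ)) atTop (𝓝 (1 + 0)) :=
      tendsto_const_nhds.add tendsto_one_div_atTop_nhds_zero_nat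
    rw [add_zero] at this
    refine this.congr' ?_
    filter_upwards [eventually_gt_atTop 0] with n hn
    have : (n : ℝ) ≠ 0 := by positivity
    push_cast
    field_simp
  have h2 := ((h.comp (tendsto_add_atTop_nat 1)).mul h1).sub h
  rw [mul_one, sub_self] at h2
  refine h2.congr' ?_
  filter_upwards [eventually_gt_atTop 0] with n hn
  have : (n : ℝ) ≠ 0 := by positivity
  have : ((n + 1 : ℕ) : ℝ) ≠ 0 := by positivity
  simp only [Function.comp, Finset.sum_range_succ]
  field_simp
  ring

theorem integrable_id_expMeasure_one : Integrable id (expMeasure 1) := by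
  rw [expMeasure_one_eq, integrable_withDensity_iff_integrable_smul₀' (by fun_prop) (by simp)]
  -- The first moment is the integral defining `Γ(2)`.
  have := Real.GammaIntegral_convergent two_pos
  refine this.congr (ae_of_all _ fun x => ?_)
  simp [(Real.exp_pos _).le]
  norm_num

theorem integral_id_expMeasure_one : ∫ x, x ∂(expMeasure 1) = 1 := by
  rw [integral_expMeasure_one]
  have := Real.Gamma_eq_integral two_pos
  rw [Real.Gamma_two] at this
  rw [this]
  congr 1; ext x
  norm_num

-- Growth of the points like `n` makes the weights decay like a stretched exponential; the
-- hypothesis on `log⁺ (y n)` lets `y n` consume at most half of that exponent.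
open Real in
theorem summable_pointWeight_mul {α c : ℝ} (hα : 0 < α) (hc : 0 < c) {e y : ℕ → ℝ}
    (hy0 : ∀ n, 0 ≤ y n)
    (he : Tendsto (fun n : ℕ => (∑ i ∈ Finset.range n, e i) / n) atTop (𝓝 1))
    (hy : Tendsto (fun n : ℕ => log⁺ (y n) ^ α / n) atTop (𝓝 0)) :
    Summable fun n => pointWeight α c (∑ i ∈ Finset.range (n + 1), e i) * y n := by
  -- The factor `2` comes from the eventual bound `Γ > (n + 1) / 2`. The threshold `b / 2 ^ α` in
  -- `h2` is then what gives `2 log⁺ (y n) ≤ (b n)^{1/α}`.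
  set b := α / (2 * c) with hb
  have hb0 : 0 < b := by positivity
  have hs := summable_exp_neg_mul_rpow (a := b ^ (1 / α) / 2) (p := 1 / α) (by positivity)
    (by positivity)
  refine summable_of_isBigO_nat hs (Asymptotics.IsBigO.of_bound 1 ?_)
  have h1 : ∀ᶠ n : ℕ in atTop, 1 / 2 < (∑ i ∈ Finset.range (n + 1), e i) / (n + 1 : ℕ) :=
    (he.comp (tendsto_add_atTop_nat 1)).eventually (lt_mem_nhds (by norm_num))
  have h2 : ∀ᶠ n : ℕ in atTop, log⁺ (y n) ^ α / n < b / 2 ^ α :=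
    hy.eventually (gt_mem_nhds (by positivity))
  filter_upwards [h1, h2, eventually_gt_atTop 0] with n h1 h2 hn
  have hn' : (0 : ℝ) < n := by exact_mod_cast hn
  rw [lt_div_iff₀ (by positivity)] at h1
  rw [div_lt_iff₀ hn'] at h2
  push_cast at h1
  have hL : log⁺ (y n) ≤ (b * n) ^ (1 / α) / 2 := by
    have : 2 * log⁺ (y n) ≤ (b * n) ^ (1 / α) := by
      rw [one_div, Real.le_rpow_inv_iff_of_pos (mul_nonneg two_pos.le posLog_nonneg)
        (by positivity) hα, Real.mul_rpow two_pos.le posLog_nonneg]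
      have h2' := h2.le
      rw [div_mul_eq_mul_div, le_div_iff₀ (by positivity)] at h2'
      linarith
    linarith
  have hG : (b * n) ^ (1 / α) ≤ (α * (∑ i ∈ Finset.range (n + 1), e i) / c) ^ (1 / α) := by
    refine Real.rpow_le_rpow (by positivity) ?_ (by positivity)
    rw [hb, le_div_iff₀ hc]
    have : α / (2 * c) * n * c = α * (n / 2) := by field_simp
    rw [this]
    gcongr
    linarith
  have hyL : y n ≤ exp (log⁺ (y n)) := by
    rw [posLog_eq_log_max_one (hy0 n), exp_log (by positivity)]
    exact le_max_right _ _
  rw [Real.norm_of_nonneg (mul_nonneg (pointWeight_pos _).le (hy0 n)),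
    Real.norm_of_nonneg (exp_pos _).le, one_mul]
  calc _ ≤ exp (-((α * (∑ i ∈ Finset.range (n + 1), e i) / c) ^ (1 / α))) * exp (log⁺ (y n)) :=
        mul_le_mul_of_nonneg_left hyL (exp_pos _).le
    _ ≤ _ := by
        rw [← exp_add, exp_le_exp, div_mul_eq_mul_div, ← Real.mul_rpow hb0.le hn'.le]
        linarith

end StrongLaw

/-! ### The shot noise model: almost sure absolute convergence. -/

instance : IsProbabilityMeasure uniformUnit := ⟨by simp [uniformUnit]⟩

/-- The setting of a shot noise series `∑ W_i Y_i 1_{[0, t/T]}(V_i)` with weights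
`W_i = exp (-(α Γ_i / c)^{1/α})` almost surely. -/
structure IsShotNoiseModel {Ω : Type*} [MeasurableSpace Ω] {d : ℕ} (α c : ℝ)
    (ν : Measure (EuclideanSpace ℝ (Fin d))) (E W V : ℕ → Ω → ℝ)
    (Y : ℕ → Ω → EuclideanSpace ℝ (Fin d)) (P : Measure Ω) : Prop where
  alpha_pos : 0 < α
  scale_pos : 0 < c
  isBackgroundMeasure : IsBackgroundMeasure α ν
  isIID : IsIID (fun i ω => (E i ω, (V i ω, Y i ω))) ((expMeasure 1).prod (uniformUnit.prod ν)) P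
  weight_ae_eq : ∀ᵐ ω ∂P, ∀ i, W i ω = pointWeight α c (∑ j ∈ Finset.range (i + 1), E j ω)

namespace IsShotNoiseModel

variable {Ω : Type*} [MeasurableSpace Ω] {P : Measure Ω} {d : ℕ} {α c : ℝ}
  {ν : Measure (EuclideanSpace ℝ (Fin d))} {E W V : ℕ → Ω → ℝ}
  {Y : ℕ → Ω → EuclideanSpace ℝ (Fin d)}

theorem isIID_left [IsProbabilityMeasure ν] (h : IsShotNoiseModel α c ν E W V Y P) :
    IsIID E (expMeasure 1) P := by
  have : IsProbabilityMeasure (expMeasure 1) := isProbabilityMeasure_expMeasure one_pos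
  simpa using h.isIID.comp measurable_fst

theorem isIID_mark [IsProbabilityMeasure ν] (h : IsShotNoiseModel α c ν E W V Y P) :
    IsIID V uniformUnit P := by
  have : IsProbabilityMeasure (expMeasure 1) := isProbabilityMeasure_expMeasure one_pos
  have h1 := h.isIID.comp (f := fun p => p.2.1) (by fun_prop)
  have h2 : ((expMeasure 1).prod (uniformUnit.prod ν)).map (fun p => p.2.1) = uniformUnit := by
    rw [← Function.comp_def Prod.fst Prod.snd, ← Measure.map_map measurable_fst measurable_snd]
    simp
  rwa [h2] at h1

theorem isIID_jump [IsProbabilityMeasure ν] (h : IsShotNoiseModel α c ν E W V Y P) :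
    IsIID Y ν P := by
  have : IsProbabilityMeasure (expMeasure 1) := isProbabilityMeasure_expMeasure one_pos
  have h1 := h.isIID.comp (f := fun p => p.2.2) (by fun_prop)
  have h2 : ((expMeasure 1).prod (uniformUnit.prod ν)).map (fun p => p.2.2) = ν := by
    rw [← Function.comp_def Prod.snd Prod.snd, ← Measure.map_map measurable_snd measurable_snd]
    simp
  rwa [h2] at h1

theorem aemeasurable_weight [IsProbabilityMeasure ν] (h : IsShotNoiseModel α c ν E W V Y P)
    (i : ℕ) : AEMeasurable (W i) P := by
  have hw := (continuous_pointWeight (c := c) h.alpha_pos).measurable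
  have hE := h.isIID_left.measurable
  refine AEMeasurable.congr (f := fun ω => pointWeight α c (∑ j ∈ Finset.range (i + 1), E j ω))
    (by fun_prop) ?_
  filter_upwards [h.weight_ae_eq] with ω hω using (hω i).symm

theorem ae_tendsto_average [IsProbabilityMeasure ν] (h : IsShotNoiseModel α c ν E W V Y P) :
    ∀ᵐ ω ∂P, Tendsto (fun n : ℕ => (∑ i ∈ Finset.range n, E i ω) / n) atTop (𝓝 1) := by
  have := h.isIID_left.ae_tendsto_average integrable_id_expMeasure_one
  rwa [integral_id_expMeasure_one] at this

theorem ae_tendsto_atTop [IsProbabilityMeasure ν] (h : IsShotNoiseModel α c ν E W V Y P) :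
    ∀ᵐ ω ∂P, Tendsto (fun n : ℕ => ∑ i ∈ Finset.range n, E i ω) atTop atTop := by
  filter_upwards [h.ae_tendsto_average] with ω hω
  refine (hω.pos_mul_atTop one_pos tendsto_natCast_atTop_atTop).congr' ?_
  filter_upwards [eventually_gt_atTop 0] with n hn
  have : (n : ℝ) ≠ 0 := by positivity
  field_simp

theorem ae_summable_norm [IsProbabilityMeasure ν] (h : IsShotNoiseModel α c ν E W V Y P) :
    ∀ᵐ ω ∂P, Summable fun i => ‖W i ω • Y i ω‖ := by
  have hα := h.alpha_pos
  have hm : Measurable fun y : EuclideanSpace ℝ (Fin d) => Real.posLog ‖y‖ ^ α := by fun_prop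
  -- The logarithmic moment condition is exactly integrability of `(log⁺ |Y|)^α`, as the strong law
  -- requires.
  have hi : Integrable id (ν.map fun y => Real.posLog ‖y‖ ^ α) := by
    rw [integrable_map_measure (by fun_prop) hm.aemeasurable]
    refine ⟨hm.aestronglyMeasurable, ?_⟩
    change HasFiniteIntegral (fun y => Real.posLog ‖y‖ ^ α) ν
    rw [hasFiniteIntegral_iff_ofReal
      (ae_of_all _ fun y => Real.rpow_nonneg Real.posLog_nonneg _)]
    exact h.isBackgroundMeasure.lintegral_posLog_rpow_lt_top hα
  filter_upwards [h.ae_tendsto_average, (h.isIID_jump.comp hm).ae_tendsto_average hi,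
    h.weight_ae_eq] with ω h1 h2 h3
  refine (summable_pointWeight_mul hα h.scale_pos (fun n => norm_nonneg (Y n ω)) h1
    (tendsto_div_of_tendsto_average h2)).congr fun n => ?_
  rw [norm_smul, h3, Real.norm_of_nonneg (pointWeight_pos _).le]

end IsShotNoiseModel

/-- The characteristic exponent `z ↦ ∫ (e^{i⟨z, x⟩} - 1) M(dx)` of a Lévy measure `M`. -/
noncomputable def levyExponent {d : ℕ} (M : Measure (EuclideanSpace ℝ (Fin d)))
    (z : EuclideanSpace ℝ (Fin d)) : ℂ :=
  ∫ x, (Complex.exp (Complex.I * (inner ℝ z x : ℝ)) - 1) ∂M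

/-! ### The characteristic functional of the series. -/

section Bounds

open Complex in
theorem norm_exp_I_mul_sub_one_le_min (x : ℝ) : ‖exp (I * x) - 1‖ ≤ min |x| 2 := by
  refine le_min Real.norm_exp_I_mul_ofReal_sub_one_le ?_
  rw [norm_exp_I_mul_ofReal_sub_one, norm_mul, Real.norm_ofNat, Real.norm_eq_abs]
  linarith [Real.abs_sin_le_one (x / 2)]

/-- Dominates the Lévy integrand by the integrable function `|x| ∧ 1`, uniformly over bounded `z`.
-/
theorem norm_exp_I_inner_sub_one_le {F : Type*} [NormedAddCommGroup F] [InnerProductSpace ℝ F]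
    {B : ℝ} {z : F} (hz : ‖z‖ ≤ B) (x : F) :
    ‖Complex.exp (Complex.I * (inner ℝ z x : ℝ)) - 1‖ ≤ (B + 2) * min ‖x‖ 1 := by
  have hB : 0 ≤ B := (norm_nonneg z).trans hz
  have h := norm_exp_I_mul_sub_one_le_min (inner ℝ z x)
  rcases le_total ‖x‖ 1 with hx | hx
  · rw [min_eq_left hx]
    refine (h.trans (min_le_left _ _)).trans ((abs_real_inner_le_norm z x).trans ?_)
    gcongr
    linarith
  · rw [min_eq_right hx]
    exact (h.trans (min_le_right _ _)).trans (by linarith)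

end Bounds

section RadialMeasure

variable {d : ℕ} {α c : ℝ} {ν : Measure (EuclideanSpace ℝ (Fin d))}

theorem integrable_min_norm_radialMeasure [IsFiniteMeasure ν] (hα : 0 < α)
    (hν : IsBackgroundMeasure α ν) : Integrable (fun x => min ‖x‖ 1) (radialMeasure α ν) := by
  refine ⟨by fun_prop, ?_⟩
  rw [hasFiniteIntegral_iff_ofReal (ae_of_all _ fun x => by positivity)]
  exact lintegral_min_norm_radialMeasure_lt_top hα hν

theorem integrable_min_norm_pointWeight_smul [IsFiniteMeasure ν] (hα : 0 < α) (hc : 0 < c)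
    (hν : IsBackgroundMeasure α ν) :
    Integrable (fun p : EuclideanSpace ℝ (Fin d) × ℝ => min ‖pointWeight α c p.2 • p.1‖ 1)
      (ν.prod (volume.restrict (Ioi 0))) := by
  have hw := (continuous_pointWeight (c := c) hα).measurable
  have h := (integrable_min_norm_radialMeasure hα hν).smul_measure
    (c := ENNReal.ofReal c) ENNReal.ofReal_ne_top
  rw [smul_radialMeasure_eq_map hα hc, integrable_map_measure (by fun_prop) (by fun_prop)] at h
  exact h

theorem integral_exp_pointWeight_smul [SFinite ν] (hα : 0 < α) (hc : 0 < c)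
    (z : EuclideanSpace ℝ (Fin d)) :
    ∫ p, (Complex.exp (Complex.I * (inner ℝ z (pointWeight α c p.2 • p.1) : ℝ)) - 1)
      ∂(ν.prod (volume.restrict (Ioi 0))) = c * levyExponent (radialMeasure α ν) z := by
  have hw := (continuous_pointWeight (c := c) hα).measurable
  have h : levyExponent (ENNReal.ofReal c • radialMeasure α ν) z =
      c * levyExponent (radialMeasure α ν) z := by
    simp only [levyExponent]
    rw [integral_smul_measure, ENNReal.toReal_ofReal hc.le, Complex.real_smul]
  rw [← h, smul_radialMeasure_eq_map hα hc, levyExponent,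
    integral_map (by fun_prop) (by fun_prop)]

end RadialMeasure

namespace IsShotNoiseModel

variable {Ω : Type*} [MeasurableSpace Ω] {P : Measure Ω} {d : ℕ} {α c : ℝ}
  {ν : Measure (EuclideanSpace ℝ (Fin d))} {E W V : ℕ → Ω → ℝ}
  {Y : ℕ → Ω → EuclideanSpace ℝ (Fin d)}

/-- Campbell's formula for `f(s, (v, y)) = exp(i⟨ψ(v), w(s) y⟩)`, with `w` the weight function. A
frequency `ψ` depending on the mark `v` encodes several time increments at once. -/
theorem integral_exp_tsum_inner [IsProbabilityMeasure P] [IsProbabilityMeasure ν]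
    (h : IsShotNoiseModel α c ν E W V Y P) {ψ : ℝ → EuclideanSpace ℝ (Fin d)}
    (hψ : Measurable ψ) {B : ℝ} (hB : ∀ v, ‖ψ v‖ ≤ B) :
    ∫ ω, Complex.exp (Complex.I * (∑' i, inner ℝ (ψ (V i ω)) (W i ω • Y i ω) : ℝ)) ∂P =
      Complex.exp (∫ v, c * levyExponent (radialMeasure α ν) (ψ v) ∂uniformUnit) := by
  have hα := h.alpha_pos
  have hwc := continuous_pointWeight (c := c) hα
  have hw := hwc.measurable
  set f : ℝ × (ℝ × EuclideanSpace ℝ (Fin d)) → ℂ := fun p => Complex.exp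
    (Complex.I * (inner ℝ (ψ p.2.1) (pointWeight α c p.1 • p.2.2) : ℝ)) with hf
  have hfm : Measurable f := by fun_prop
  have hf1 : ∀ p, ‖f p‖ ≤ 1 := fun p => by
    rw [hf]
    exact (Complex.norm_exp_I_mul_ofReal _).le
  set K : (ℝ × EuclideanSpace ℝ (Fin d)) × ℝ → ℂ := fun q => f (q.2, q.1) - 1 with hK
  have hKm : Measurable K := by fun_prop
  have hdom : Integrable (fun q : (ℝ × EuclideanSpace ℝ (Fin d)) × ℝ =>
      (B + 2) * min ‖pointWeight α c q.2 • q.1.2‖ 1)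
      ((uniformUnit.prod ν).prod (volume.restrict (Ioi 0))) := by
    refine Integrable.const_mul ?_ _
    have hmp : MeasurePreserving
        (Prod.map (Prod.snd : ℝ × EuclideanSpace ℝ (Fin d) → _) (id : ℝ → ℝ))
        ((uniformUnit.prod ν).prod (volume.restrict (Ioi 0)))
        (ν.prod (volume.restrict (Ioi 0))) :=
      measurePreserving_snd.prod (MeasurePreserving.id _)
    exact hmp.integrable_comp_of_integrable
      (integrable_min_norm_pointWeight_smul hα h.scale_pos h.isBackgroundMeasure)
  have hKle : ∀ q, ‖K q‖ ≤ (B + 2) * min ‖pointWeight α c q.2 • q.1.2‖ 1 := fun q =>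
    norm_exp_I_inner_sub_one_le (hB _) _
  have hKi : Integrable K ((uniformUnit.prod ν).prod (volume.restrict (Ioi 0))) :=
    hdom.mono' hKm.aestronglyMeasurable (ae_of_all _ hKle)
  have hfi : ∀ x, Integrable (fun s => f (x, s)) (uniformUnit.prod ν) := fun x =>
    Integrable.of_bound (hfm.comp (by fun_prop)).aestronglyMeasurable 1
      (ae_of_all _ fun s => hf1 _)
  have hKx : ∀ x, ∫ s, K (s, x) ∂(uniformUnit.prod ν) =
      (∫ s, f (x, s) ∂(uniformUnit.prod ν)) - 1 := fun x => by
    simp only [hK]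
    rw [integral_sub (hfi x) (integrable_const _)]
    simp
  have hg : Continuous fun x => ∫ s, f (x, s) ∂(uniformUnit.prod ν) := by
    refine continuous_of_dominated (bound := fun _ => 1) (fun x => (hfi x).1)
      (fun x => ae_of_all _ fun s => hf1 _) (integrable_const _) (ae_of_all _ fun s => ?_)
    simp only [hf]
    fun_prop
  have hint : IntegrableOn (fun x => (∫ s, f (x, s) ∂(uniformUnit.prod ν)) - 1) (Ioi 0) := by
    have := hKi.integral_prod_right
    simp only [hKx] at this
    exact this
  have key := integral_tendsto_prod_marked_poisson h.isIID h.ae_tendsto_atTop hfm hf1 hg hint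
    (F := fun ω => Complex.exp (Complex.I *
      (∑' i, inner ℝ (ψ (V i ω)) (W i ω • Y i ω) : ℝ))) ?_
  · rw [key]
    congr 1
    simp only [← hKx]
    -- Fubini moves the integral over `v` outermost; for fixed `v` the integral over `(y, s)` is the
    -- exponent of `c M_α` at `ψ v`.
    rw [← integral_prod_symm _ hKi, integral_prod _ hKi, integral_prod _ hKi.integral_prod_left]
    congr 1; ext v
    rw [← integral_exp_pointWeight_smul hα h.scale_pos, integral_prod]
    refine ((integrable_min_norm_pointWeight_smul hα h.scale_pos
      h.isBackgroundMeasure).const_mul (B + 2)).mono' (by fun_prop) (ae_of_all _ fun p => ?_)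
    exact norm_exp_I_inner_sub_one_le (hB _) _
  · filter_upwards [h.ae_summable_norm, h.weight_ae_eq] with ω h1 h2
    have hs : Summable fun i => inner ℝ (ψ (V i ω)) (W i ω • Y i ω) := by
      refine Summable.of_norm_bounded (h1.mul_left B) fun i => ?_
      refine (norm_inner_le_norm _ _).trans ?_
      gcongr
      exact hB _
    have ht := hs.hasSum.tendsto_sum_nat
    have ht' := (Complex.continuous_exp.tendsto _).comp
      (((Complex.continuous_ofReal.tendsto _).comp ht).const_mul Complex.I)
    refine ht'.congr fun n => ?_
    simp only [Function.comp, hf]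
    rw [← Complex.exp_sum, Complex.ofReal_sum, Finset.mul_sum]
    simp only [h2]

end IsShotNoiseModel

theorem uniformUnit_real_Ioc {a b : ℝ} (ha : 0 ≤ a) (hab : a ≤ b) (hb : b ≤ 1) :
    uniformUnit.real (Ioc a b) = b - a := by
  rw [uniformUnit, Measure.restrict_congr_set Ioo_ae_eq_Ioc, measureReal_restrict_apply measurableSet_Ioc,
    inter_eq_left.2 (Ioc_subset_Ioc ha hb), Real.volume_real_Ioc_of_le hab]

/-! ### Path properties, for a fixed outcome with absolutely summable terms. -/

section Paths

variable {Ω : Type*} {d : ℕ} {T : ℝ} {γ : EuclideanSpace ℝ (Fin d)} {W V : ℕ → Ω → ℝ}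
  {Y : ℕ → Ω → EuclideanSpace ℝ (Fin d)} {ω : Ω}

theorem norm_shotTerm_le (t : ℝ) (i : ℕ) : ‖shotTerm T W V Y t ω i‖ ≤ ‖W i ω • Y i ω‖ := by
  unfold shotTerm
  rw [mul_comm, mul_smul, norm_smul]
  refine mul_le_of_le_one_left (norm_nonneg _) ?_
  by_cases hv : V i ω ∈ Icc 0 (t / T) <;> simp [hv]

theorem summable_shotTerm (h : Summable fun i => ‖W i ω • Y i ω‖) (t : ℝ) :
    Summable (shotTerm T W V Y t ω) :=
  Summable.of_norm_bounded h fun i => norm_shotTerm_le t i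

/-- Dominated convergence for series: it is enough that each term is eventually constant along the
filter. Right continuity, left limits and continuity at a fixed time are all instances. -/
theorem tendsto_shotNoise (h : Summable fun i => ‖W i ω • Y i ω‖) {l : Filter ℝ} {t : ℝ}
    (hl : l ≤ 𝓝 t) {g : ℕ → EuclideanSpace ℝ (Fin d)}
    (hg : ∀ i, ∀ᶠ s in l, shotTerm T W V Y s ω i = g i) :
    Tendsto (fun s => shotNoise T γ W V Y s ω) l (𝓝 (t • γ + ∑' i, g i)) := by
  have h1 : Tendsto (fun s : ℝ => s • γ) l (𝓝 (t • γ)) :=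
    ((continuous_id.smul continuous_const).tendsto t).mono_left hl
  refine h1.add ?_
  exact tendsto_tsum_of_dominated_convergence h
    (fun i => tendsto_const_nhds.congr' ((hg i).mono fun _ hs => hs.symm))
    (Eventually.of_forall fun s i => norm_shotTerm_le s i)

theorem shotTerm_congr {s t : ℝ} {i : ℕ} (h : V i ω ∈ Icc 0 (s / T) ↔ V i ω ∈ Icc 0 (t / T)) :
    shotTerm T W V Y s ω i = shotTerm T W V Y t ω i := by
  simp only [shotTerm, indicator_apply, h]

theorem tendstoUniformlyOn_shotPartial (h : Summable fun i => ‖W i ω • Y i ω‖) (s : Set ℝ) :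
    TendstoUniformlyOn (fun n t => shotPartial T γ W V Y n t ω)
      (fun t => shotNoise T γ W V Y t ω) atTop s := by
  have h1 := tendstoUniformlyOn_tsum_nat (f := fun i t => shotTerm T W V Y t ω i) h (s := s)
    fun i t _ => norm_shotTerm_le t i
  rw [Metric.tendstoUniformlyOn_iff] at h1 ⊢
  simpa [shotPartial, shotNoise] using h1

theorem continuousWithinAt_shotNoise_Icc (hT : 0 < T) (h : Summable fun i => ‖W i ω • Y i ω‖)
    (t : ℝ) : ContinuousWithinAt (fun s => shotNoise T γ W V Y s ω) (Icc t T) t := by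
  refine tendsto_shotNoise h nhdsWithin_le_nhds fun i => ?_
  by_cases hv : V i ω ≤ t / T
  · filter_upwards [self_mem_nhdsWithin] with s hs
    have : t / T ≤ s / T := div_le_div_of_nonneg_right hs.1 hT.le
    exact shotTerm_congr ⟨fun h => ⟨h.1, hv⟩, fun h => ⟨h.1, hv.trans this⟩⟩
  · rw [not_le, div_lt_iff₀ hT] at hv
    filter_upwards [nhdsWithin_le_nhds (gt_mem_nhds hv)] with s hs
    refine shotTerm_congr ⟨fun h => ?_, fun h => ?_⟩
    · exact absurd h.2 (not_le.2 ((div_lt_iff₀ hT).2 hs))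
    · exact absurd h.2 (not_le.2 ((div_lt_iff₀ hT).2 hv))

theorem exists_leftLim_shotNoise (hT : 0 < T) (h : Summable fun i => ‖W i ω • Y i ω‖)
    (t : ℝ) : ∃ l, Tendsto (fun s => shotNoise T γ W V Y s ω) (𝓝[Ico 0 t] t) (𝓝 l) := by
  -- In the left limit a jump exactly at time `t` is not yet counted, hence `Ico` in place of `Icc`.
  refine ⟨_, tendsto_shotNoise h nhdsWithin_le_nhds (g := fun i =>
    (W i ω * (Ico 0 (t / T)).indicator (fun _ => (1 : ℝ)) (V i ω)) • Y i ω) fun i => ?_⟩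
  have hmem : ∀ᶠ s in 𝓝[Ico 0 t] t, (V i ω ∈ Icc 0 (s / T) ↔ V i ω ∈ Ico 0 (t / T)) := by
    by_cases hv : V i ω < t / T
    · have hv' := (lt_div_iff₀ hT).1 hv
      filter_upwards [nhdsWithin_le_nhds (lt_mem_nhds hv')] with s hs
      exact ⟨fun h => ⟨h.1, hv⟩, fun h => ⟨h.1, ((lt_div_iff₀ hT).2 hs).le⟩⟩
    · filter_upwards [self_mem_nhdsWithin] with s hs
      have : s / T < t / T := div_lt_div_of_pos_right hs.2 hT
      exact ⟨fun h => absurd (h.2.trans_lt this) hv, fun h => absurd h.2 hv⟩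
  filter_upwards [hmem] with s hs
  simp only [shotTerm, indicator_apply, hs]

theorem continuousAt_shotNoise (hT : 0 < T) (h : Summable fun i => ‖W i ω • Y i ω‖)
    {t : ℝ} (ht : ∀ i, V i ω ≠ t / T) : ContinuousAt (fun s => shotNoise T γ W V Y s ω) t := by
  refine tendsto_shotNoise h le_rfl fun i => ?_
  rcases (ht i).lt_or_gt with hv | hv
  · filter_upwards [lt_mem_nhds ((lt_div_iff₀ hT).1 hv)] with s hs
    exact shotTerm_congr ⟨fun h => ⟨h.1, hv.le⟩, fun h => ⟨h.1, ((lt_div_iff₀ hT).2 hs).le⟩⟩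
  · filter_upwards [gt_mem_nhds ((div_lt_iff₀ hT).1 hv)] with s hs
    exact shotTerm_congr ⟨fun h => absurd h.2 (not_le.2 ((div_lt_iff₀ hT).2 hs)),
      fun h => absurd h.2 (not_le.2 hv)⟩

theorem shotNoise_sub (hT : 0 < T) (h : Summable fun i => ‖W i ω • Y i ω‖) {s t : ℝ}
    (hs : 0 ≤ s) (hst : s ≤ t) :
    shotNoise T γ W V Y t ω - shotNoise T γ W V Y s ω =
      (t - s) • γ + ∑' i, (Ioc (s / T) (t / T)).indicator (fun _ => (1 : ℝ)) (V i ω) •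
        W i ω • Y i ω := by
  have h1 := (summable_shotTerm (T := T) (V := V) h t).tsum_sub
    (summable_shotTerm (T := T) (V := V) h s)
  unfold shotNoise
  rw [add_sub_add_comm, ← h1, sub_smul]
  congr 2; ext1 i
  have h0 : 0 ≤ s / T := by positivity
  have h2 : s / T ≤ t / T := by gcongr
  unfold shotTerm
  rw [← sub_smul, ← mul_sub, mul_comm, mul_smul]
  congr 1
  simp only [indicator_apply, mem_Icc, mem_Ioc]
  grind

theorem inner_shotNoise_sub (hT : 0 < T) (h : Summable fun i => ‖W i ω • Y i ω‖) {s t : ℝ}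
    (hs : 0 ≤ s) (hst : s ≤ t) (z : EuclideanSpace ℝ (Fin d)) :
    HasSum (fun i => inner ℝ ((Ioc (s / T) (t / T)).indicator (fun _ => z) (V i ω))
        (W i ω • Y i ω))
      (inner ℝ z (shotNoise T γ W V Y t ω - shotNoise T γ W V Y s ω) -
        (t - s) * inner ℝ z γ) := by
  rw [shotNoise_sub hT h hs hst, inner_add_right, real_inner_smul_right, add_sub_cancel_left]
  have hsum : Summable fun i => (Ioc (s / T) (t / T)).indicator (fun _ => (1 : ℝ)) (V i ω) •
      W i ω • Y i ω := by
    refine Summable.of_norm_bounded h fun i => ?_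
    rw [norm_smul]
    refine mul_le_of_le_one_left (norm_nonneg _) ?_
    by_cases hv : V i ω ∈ Ioc (s / T) (t / T) <;> simp [hv]
  have := hsum.hasSum.mapL (innerSL ℝ z)
  simp only [innerSL_apply_apply] at this
  have e : (fun i => inner ℝ ((Ioc (s / T) (t / T)).indicator (fun _ => z) (V i ω))
      (W i ω • Y i ω)) = fun i => inner ℝ z
        ((Ioc (s / T) (t / T)).indicator (fun _ => (1 : ℝ)) (V i ω) • W i ω • Y i ω) := by
    ext i
    by_cases hv : V i ω ∈ Ioc (s / T) (t / T) <;> simp [hv]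
  rwa [e]

end Paths

/-- At each point at most one summand is nonzero, so `η` passes through the sum without being
additive. -/
theorem apply_sum_indicator_of_pairwise_disjoint {ι β F G : Type*} [Fintype ι]
    [AddCommMonoid F] [AddCommMonoid G] {I : ι → Set β} (hI : Pairwise fun j k => Disjoint (I j) (I k))
    (z : ι → F) {η : F → G} (hη : η 0 = 0) (v : β) :
    η (∑ k, (I k).indicator (fun _ => z k) v) = ∑ k, (I k).indicator (fun _ => η (z k)) v := by
  classical
  by_cases hv : ∃ k, v ∈ I k
  · obtain ⟨k, hk⟩ := hv
    have h0 : ∀ j ≠ k, v ∉ I j := fun j hj hvj => disjoint_left.1 (hI hj) hvj hk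
    rw [Finset.sum_eq_single k (fun j _ hj => indicator_of_notMem (h0 j hj) _) (by simp),
      Finset.sum_eq_single k (fun j _ hj => indicator_of_notMem (h0 j hj) _) (by simp),
      indicator_of_mem hk, indicator_of_mem hk]
  · push Not at hv
    simp [indicator_of_notMem (hv _), hη]

/-! ### Joint characteristic function of the increments. -/

namespace IsShotNoiseModel

variable {Ω : Type*} [MeasurableSpace Ω] {P : Measure Ω} {d : ℕ} {α c T : ℝ}
  {ν : Measure (EuclideanSpace ℝ (Fin d))} {E W V : ℕ → Ω → ℝ}
  {Y : ℕ → Ω → EuclideanSpace ℝ (Fin d)}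

/-- Apart from the drift, the combination of increments is the series with step frequency `ψ = ∑
1_{I_k} z_k`. The exponent vanishes at `0` and the `I_k` are disjoint, so its integral over `v` is a
sum weighted by the lengths `(b_k - a_k) / T`. -/
theorem integral_exp_sum_inner_increments [IsProbabilityMeasure P] [IsProbabilityMeasure ν]
    (h : IsShotNoiseModel α c ν E W V Y P) (hT : 0 < T) (γ : EuclideanSpace ℝ (Fin d))
    {ι : Type*} [Fintype ι] {a b : ι → ℝ} (ha : ∀ k, 0 ≤ a k) (hab : ∀ k, a k ≤ b k)
    (hb : ∀ k, b k ≤ T)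
    (hI : Pairwise fun j k => Disjoint (Ioc (a j) (b j)) (Ioc (a k) (b k)))
    (z : ι → EuclideanSpace ℝ (Fin d)) :
    ∫ ω, Complex.exp (Complex.I * (∑ k, inner ℝ (z k)
        (shotNoise T γ W V Y (b k) ω - shotNoise T γ W V Y (a k) ω) : ℝ)) ∂P =
      ∏ k, Complex.exp ((b k - a k : ℝ) * (Complex.I * (inner ℝ (z k) γ : ℝ) +
        c / T * levyExponent (radialMeasure α ν) (z k))) := by
  set I : ι → Set ℝ := fun k => Ioc (a k / T) (b k / T) with hIdef
  have hI' : Pairwise fun j k => Disjoint (I j) (I k) := by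
    intro j k hjk
    have := hI hjk
    simp only [Set.disjoint_left, mem_Ioc, hIdef, div_lt_iff₀ hT, le_div_iff₀ hT]
      at this ⊢
    exact fun x hx => this hx
  have hIm : ∀ k, MeasurableSet (I k) := fun k => measurableSet_Ioc
  set ψ : ℝ → EuclideanSpace ℝ (Fin d) := fun v => ∑ k, (I k).indicator (fun _ => z k) v with hψ
  have hψm : Measurable ψ :=
    Finset.measurable_sum _ fun k _ => measurable_const.indicator (hIm k)
  have hψB : ∀ v, ‖ψ v‖ ≤ ∑ k, ‖z k‖ := fun v =>
    (norm_sum_le _ _).trans (Finset.sum_le_sum fun k _ => norm_indicator_le_norm_self _ _)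
  have hη : (fun z => c * levyExponent (radialMeasure α ν) z) 0 = 0 := by simp [levyExponent]
  have hexp : ∫ v, c * levyExponent (radialMeasure α ν) (ψ v) ∂uniformUnit =
      ∑ k, (b k - a k : ℝ) * (c / T * levyExponent (radialMeasure α ν) (z k)) := by
    have h1 : ∀ v, c * levyExponent (radialMeasure α ν) (ψ v) = ∑ k, (I k).indicator
        (fun _ => c * levyExponent (radialMeasure α ν) (z k)) v := fun v =>
      apply_sum_indicator_of_pairwise_disjoint hI' z
        (η := fun z => c * levyExponent (radialMeasure α ν) z) hη v
    simp only [h1]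
    rw [integral_finsetSum _ fun k _ => (integrable_const _).indicator (hIm k)]
    refine Finset.sum_congr rfl fun k _ => ?_
    rw [integral_indicator (hIm k), setIntegral_const, uniformUnit_real_Ioc
      (div_nonneg (ha k) hT.le) (div_le_div_of_nonneg_right (hab k) hT.le)
      ((div_le_one hT).2 (hb k)), Complex.real_smul]
    push_cast
    ring
  have hpath : ∀ᵐ ω ∂P, ∑ k, inner ℝ (z k)
      (shotNoise T γ W V Y (b k) ω - shotNoise T γ W V Y (a k) ω) =
      ∑ k, (b k - a k) * inner ℝ (z k) γ + ∑' i, inner ℝ (ψ (V i ω)) (W i ω • Y i ω) := by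
    filter_upwards [h.ae_summable_norm] with ω hω
    have hs := hasSum_sum (s := Finset.univ) fun k _ =>
      inner_shotNoise_sub (γ := γ) (V := V) hT hω (ha k) (hab k) (z k)
    simp only [← sum_inner] at hs
    rw [hs.tsum_eq, Finset.sum_sub_distrib]
    ring
  rw [integral_congr_ae (g := fun ω =>
    Complex.exp (Complex.I * (∑ k, (b k - a k) * inner ℝ (z k) γ : ℝ)) *
      Complex.exp (Complex.I * (∑' i, inner ℝ (ψ (V i ω)) (W i ω • Y i ω) : ℝ))) ?_,
    integral_const_mul, h.integral_exp_tsum_inner hψm hψB, hexp, ← Complex.exp_add,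
    ← Complex.exp_sum]
  · congr 1
    push_cast
    rw [Finset.mul_sum, ← Finset.sum_add_distrib]
    exact Finset.sum_congr rfl fun k _ => by ring
  · filter_upwards [hpath] with ω hω
    rw [hω, ← Complex.exp_add]
    push_cast
    ring_nf

theorem aemeasurable_shotNoise [IsProbabilityMeasure ν] (h : IsShotNoiseModel α c ν E W V Y P)
    (T : ℝ) (γ : EuclideanSpace ℝ (Fin d)) (t : ℝ) : AEMeasurable (shotNoise T γ W V Y t) P := by
  refine aemeasurable_of_tendsto_metrizable_ae atTop
    (f := fun n => shotPartial T γ W V Y n t) (fun n => ?_) ?_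
  · have hW := h.aemeasurable_weight
    have hV := h.isIID_mark.measurable
    have hY := h.isIID_jump.measurable
    refine aemeasurable_const.add ?_
    refine Finset.aemeasurable_fun_sum _ fun i _ => ?_
    refine ((hW i).mul ?_).smul (hY i).aemeasurable
    exact ((measurable_const.indicator measurableSet_Icc).comp (hV i)).aemeasurable
  · filter_upwards [h.ae_summable_norm] with ω hω
    exact (tendstoUniformlyOn_shotPartial hω univ).tendsto_at (mem_univ t)

theorem charFun_map_shotNoise_sub [IsProbabilityMeasure P] [IsProbabilityMeasure ν]
    (h : IsShotNoiseModel α c ν E W V Y P) (hT : 0 < T) (γ : EuclideanSpace ℝ (Fin d))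
    {a b : ℝ} (ha : 0 ≤ a) (hab : a ≤ b) (hb : b ≤ T) (z : EuclideanSpace ℝ (Fin d)) :
    charFun (P.map fun ω => shotNoise T γ W V Y b ω - shotNoise T γ W V Y a ω) z =
      Complex.exp ((b - a : ℝ) * (Complex.I * (inner ℝ z γ : ℝ) +
        c / T * levyExponent (radialMeasure α ν) z)) := by
  have hm : AEMeasurable (fun ω => shotNoise T γ W V Y b ω - shotNoise T γ W V Y a ω) P :=
    (h.aemeasurable_shotNoise T γ b).sub (h.aemeasurable_shotNoise T γ a)
  have := h.integral_exp_sum_inner_increments hT γ (ι := Unit) (fun _ => ha) (fun _ => hab)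
    (fun _ => hb) (fun _ _ hij => (hij rfl).elim) fun _ => z
  simp only [Finset.univ_unique, Finset.sum_singleton, Finset.prod_singleton] at this
  rw [← this, charFun_apply, integral_map hm (by fun_prop)]
  refine integral_congr_ae (ae_of_all _ fun ω => ?_)
  simp only
  rw [mul_comm, real_inner_comm]

theorem ae_mark_ne [IsProbabilityMeasure ν] (h : IsShotNoiseModel α c ν E W V Y P)
    (i : ℕ) (v : ℝ) : ∀ᵐ ω ∂P, V i ω ≠ v := by
  have h1 : ∀ᵐ x ∂(P.map (V i)), x ≠ v := by
    rw [h.isIID_mark.map_eq, uniformUnit, ae_iff]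
    simp
  exact ae_of_ae_map (h.isIID_mark.measurable i).aemeasurable h1

/-- Only marks equal to `0` contribute at time `0`, and the uniform law has no atoms. -/
theorem ae_shotNoise_zero [IsProbabilityMeasure ν] (h : IsShotNoiseModel α c ν E W V Y P)
    (T : ℝ) (γ : EuclideanSpace ℝ (Fin d)) : ∀ᵐ ω ∂P, shotNoise T γ W V Y 0 ω = 0 := by
  filter_upwards [ae_all_iff.2 fun i => h.ae_mark_ne i 0] with ω hω
  have : ∀ i, shotTerm T W V Y 0 ω i = 0 := fun i => by
    simp [shotTerm, hω i]
  simp [shotNoise, this]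

end IsShotNoiseModel

/-! ### The Lévy process property. -/

namespace IsShotNoiseModel

variable {Ω : Type*} [MeasurableSpace Ω] {P : Measure Ω} {d : ℕ} {α c T : ℝ}
  {ν : Measure (EuclideanSpace ℝ (Fin d))} {E W V : ℕ → Ω → ℝ}
  {Y : ℕ → Ω → EuclideanSpace ℝ (Fin d)}

theorem hasIndepIncrements [IsProbabilityMeasure P] [IsProbabilityMeasure ν]
    (h : IsShotNoiseModel α c ν E W V Y P) (hT : 0 < T) (γ : EuclideanSpace ℝ (Fin d)) :
    HasIndepIncrements (fun t : Icc (0 : ℝ) T => shotNoise T γ W V Y t) P := by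
  intro n t ht
  have hm : ∀ i : Fin n, AEMeasurable (fun ω => shotNoise T γ W V Y (t i.succ) ω -
      shotNoise T γ W V Y (t i.castSucc) ω) P := fun i =>
    (h.aemeasurable_shotNoise T γ _).sub (h.aemeasurable_shotNoise T γ _)
  have hle : ∀ i : Fin n, (t i.castSucc : ℝ) ≤ t i.succ := fun i => ht (Fin.castSucc_le_succ i)
  have hI : Pairwise fun j k : Fin n => Disjoint (Ioc (t j.castSucc : ℝ) (t j.succ))
      (Ioc (t k.castSucc : ℝ) (t k.succ)) := by
    have hlt : ∀ j k : Fin n, j < k → Disjoint (Ioc (t j.castSucc : ℝ) (t j.succ))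
        (Ioc (t k.castSucc : ℝ) (t k.succ)) := fun j k hjk => by
      have h1 : (t j.succ : ℝ) ≤ t k.castSucc := ht (Fin.succ_le_castSucc_iff.2 hjk)
      exact disjoint_left.2 fun x hx hx' => absurd (hx.2.trans h1) (not_le.2 hx'.1)
    intro j k hjk
    rcases lt_or_gt_of_ne hjk with hjk | hjk
    · exact hlt j k hjk
    · exact (hlt k j hjk).symm
  -- Independence is equivalent to factorisation of the joint characteristic function.
  rw [iIndepFun_iff_charFun_pi hm]
  intro z
  have hm' : AEMeasurable (fun ω => WithLp.toLp 2 fun i : Fin n =>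
      shotNoise T γ W V Y (t i.succ) ω - shotNoise T γ W V Y (t i.castSucc) ω) P :=
    (WithLp.measurable_toLp 2 _).comp_aemeasurable (aemeasurable_pi_lambda _ hm)
  simp only [fun i => h.charFun_map_shotNoise_sub hT γ (t i.castSucc).2.1 (hle i)
    (t i.succ).2.2 (z i)]
  rw [← h.integral_exp_sum_inner_increments hT γ (a := fun i => (t i.castSucc : ℝ))
    (b := fun i => (t i.succ : ℝ)) (fun i => (t i.castSucc).2.1) hle
    (fun i => (t i.succ).2.2) hI (fun i => z i), charFun_apply, integral_map hm' (by fun_prop)]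
  refine integral_congr_ae (ae_of_all _ fun ω => ?_)
  simp only [PiLp.inner_apply]
  rw [mul_comm]
  simp only [real_inner_comm]

theorem isLevyProcessOn [IsProbabilityMeasure P] [IsProbabilityMeasure ν]
    (h : IsShotNoiseModel α c ν E W V Y P) (hT : 0 < T) (γ : EuclideanSpace ℝ (Fin d)) :
    IsLevyProcessOn T (shotNoise T γ W V Y) P where
  aemeasurable t _ := h.aemeasurable_shotNoise T γ t
  start_zero := h.ae_shotNoise_zero T γ
  indep_increments := h.hasIndepIncrements hT γ
  stationary_increments s k hs hk hsk := by
    have hm := h.aemeasurable_shotNoise T γ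
    have h1 : AEMeasurable (fun ω => shotNoise T γ W V Y (s + k) ω - shotNoise T γ W V Y s ω) P :=
      (hm _).sub (hm _)
    have h2 : AEMeasurable (fun ω => shotNoise T γ W V Y k ω - shotNoise T γ W V Y 0 ω) P :=
      (hm _).sub (hm _)
    have := Measure.isProbabilityMeasure_map h1
    have := Measure.isProbabilityMeasure_map h2
    refine Measure.ext_of_charFun (funext fun z => ?_)
    rw [h.charFun_map_shotNoise_sub hT γ hs (by linarith) hsk,
      h.charFun_map_shotNoise_sub hT γ le_rfl hk (by linarith)]
    simp
  stoch_continuous t _ := by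
    intro ε hε
    -- Along sequences, convergence in measure follows from almost sure convergence: almost surely
    -- no mark equals `t / T`, and then the path is continuous at `t`.
    refine tendsto_of_seq_tendsto fun u hu => ?_
    refine tendstoInMeasure_of_tendsto_ae (f := fun n => shotNoise T γ W V Y (u n))
      (fun n => (h.aemeasurable_shotNoise T γ _).aestronglyMeasurable) ?_ ε hε
    filter_upwards [h.ae_summable_norm, ae_all_iff.2 fun i => h.ae_mark_ne i (t / T)] with ω h1 h2
    exact (continuousAt_shotNoise hT h1 h2).tendsto.comp (hu.mono_right nhdsWithin_le_nhds)
  cadlag := by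
    filter_upwards [h.ae_summable_norm] with ω hω
    exact ⟨fun t _ => continuousWithinAt_shotNoise_Icc hT hω t,
      fun t _ => exists_leftLim_shotNoise hT hω t⟩

theorem shotUniformlyConverges [IsProbabilityMeasure ν] (h : IsShotNoiseModel α c ν E W V Y P)
    (T : ℝ) (γ : EuclideanSpace ℝ (Fin d)) : ShotUniformlyConverges T γ W V Y P := by
  filter_upwards [h.ae_summable_norm] with ω hω
  exact tendstoUniformlyOn_shotPartial hω _

theorem charFun_map_shotNoise [IsProbabilityMeasure P] [IsProbabilityMeasure ν]
    (h : IsShotNoiseModel α c ν E W V Y P) (hT : 0 < T) (γ : EuclideanSpace ℝ (Fin d)) {t : ℝ}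
    (ht : t ∈ Icc 0 T) (z : EuclideanSpace ℝ (Fin d)) :
    charFun (P.map (shotNoise T γ W V Y t)) z = Complex.exp (t * (Complex.I *
      (inner ℝ z γ : ℝ) + c / T * levyExponent (radialMeasure α ν) z)) := by
  rw [show (t : ℂ) = ((t - 0 : ℝ) : ℂ) by simp,
    ← h.charFun_map_shotNoise_sub hT γ le_rfl ht.1 ht.2 z]
  congr 1
  refine Measure.map_congr ?_
  filter_upwards [h.ae_shotNoise_zero T γ] with ω hω
  simp [hω]

end IsShotNoiseModel

/-! ### Normalisation of `ν` and identification of the marginal law. -/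

theorem IsBackgroundMeasure.smul {d : ℕ} {α : ℝ} {ν : Measure (EuclideanSpace ℝ (Fin d))}
    (hν : IsBackgroundMeasure α ν) {a : ENNReal} (ha : a ≠ ⊤) :
    IsBackgroundMeasure α (a • ν) where
  zero_singleton := by simp [hν.zero_singleton]
  integral_lt_top := by
    have := hν.integral_lt_top
    rw [Measure.restrict_smul, Measure.restrict_smul, lintegral_smul_measure,
      lintegral_smul_measure, ← smul_add, smul_eq_mul]
    exact ENNReal.mul_lt_top ha.lt_top this

theorem levyExponent_smul_measure {d : ℕ} (M : Measure (EuclideanSpace ℝ (Fin d)))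
    (a : ENNReal) (z : EuclideanSpace ℝ (Fin d)) :
    levyExponent (a • M) z = a.toReal * levyExponent M z := by
  simp only [levyExponent]
  rw [integral_smul_measure, Complex.real_smul]

section Normalized

variable {Ω : Type*} [MeasurableSpace Ω] {P : Measure Ω} {d : ℕ} {α T : ℝ}
  {ν : Measure (EuclideanSpace ℝ (Fin d))} {E W V : ℕ → Ω → ℝ}
  {Y : ℕ → Ω → EuclideanSpace ℝ (Fin d)}

/-- With `c = T θ` and jumps distributed as `ν / θ`, the rate `c / T = θ` cancels the normalisation,
leaving `t` times the exponent of `M_α` built from `ν`. -/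
theorem IsShotNoiseModel.isLStar_map_shotNoise [IsProbabilityMeasure P] [IsFiniteMeasure ν]
    (hν0 : ν ≠ 0) (hν : IsBackgroundMeasure α ν)
    (h : IsShotNoiseModel α (T * ν.real univ) ((ν univ)⁻¹ • ν) E W V Y P) (hT : 0 < T)
    (γ : EuclideanSpace ℝ (Fin d)) {t : ℝ} (ht : t ∈ Icc 0 T) :
    IsLStar α (ENNReal.ofReal t • ν) (t • γ) (P.map (shotNoise T γ W V Y t)) := by
  have : NeZero ν := ⟨hν0⟩
  have hfin : IsFiniteMeasure (ENNReal.ofReal t • ν) :=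
    Measure.smul_finite ν ENNReal.ofReal_ne_top
  have hbg := hν.smul (a := ENNReal.ofReal t) ENNReal.ofReal_ne_top
  refine ⟨hfin, hbg,
    Measure.isProbabilityMeasure_map (h.aemeasurable_shotNoise T γ t),
    radialMeasure_singleton_zero hbg.zero_singleton,
    lintegral_min_norm_radialMeasure_lt_top h.alpha_pos hbg, fun z => ?_⟩
  rw [h.charFun_map_shotNoise hT γ ht]
  change _ = Complex.exp (_ + levyExponent _ z)
  rw [radialMeasure_smul_measure, radialMeasure_smul_measure, levyExponent_smul_measure,
    levyExponent_smul_measure, ENNReal.toReal_ofReal ht.1, real_inner_smul_left,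
    real_inner_comm, ENNReal.toReal_inv]
  have hθ : (ν univ).toReal ≠ 0 :=
    (ENNReal.toReal_pos (NeZero.ne _) (measure_ne_top ν univ)).ne'
  have hθ' : ((ν univ).toReal : ℂ) ≠ 0 := by exact_mod_cast hθ
  have hT' : (T : ℂ) ≠ 0 := by exact_mod_cast hT.ne'
  congr 1
  rw [Measure.real]
  push_cast
  field_simp

theorem isShotNoiseModel_of_ae_eq [IsProbabilityMeasure P] [IsFiniteMeasure ν] (hα : 0 < α)
    (hν0 : ν ≠ 0) (hν : IsBackgroundMeasure α ν) (hT : 0 < T) (hE : IsIID E (expMeasure 1) P)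
    (hV : IsIID V uniformUnit P) (hY : IsIID Y ((ν univ)⁻¹ • ν) P)
    (hEVY : IndepSequences E V Y P)
    (hW : ∀ᵐ ω ∂P, ∀ i, W i ω = expWeight α T (ν.real univ) E i ω) :
    IsShotNoiseModel α (T * ν.real univ) ((ν univ)⁻¹ • ν) E W V Y P where
  alpha_pos := hα
  scale_pos := by
    have : NeZero ν := ⟨hν0⟩
    exact mul_pos hT (ENNReal.toReal_pos (NeZero.ne _) (measure_ne_top ν univ))
  isBackgroundMeasure := hν.smul (by simpa using hν0)
  isIID := by
    refine hE.prodMk (hV.prodMk hY hEVY.indep_right) ?_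
    exact hEVY.indep_left.comp measurable_id
      (measurable_pi_lambda (fun p : (ℕ → ℝ) × (ℕ → EuclideanSpace ℝ (Fin d)) => fun i =>
        (p.1 i, p.2 i)) fun i => by fun_prop)
  weight_ae_eq := hW

end Normalized

/-! ### The case `α = 1` and the conclusion. -/

theorem expWeight_one_eq_prodWeight {Ω : Type*} (T θ : ℝ) (E : ℕ → Ω → ℝ) (i : ℕ) (ω : Ω) :
    expWeight 1 T θ E i ω = prodWeight T θ (fun i ω => Real.exp (-E i ω)) i ω := by
  simp only [expWeight, prodWeight, ← Real.exp_sum, ← Real.exp_mul]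
  rw [Finset.sum_neg_distrib]
  congr 1
  rw [div_one, Real.rpow_one]
  ring

theorem map_neg_log_uniformUnit :
    uniformUnit.map (fun r => -Real.log r) = expMeasure 1 := by
  rw [← map_exp_neg_expMeasure_one, Measure.map_map (by fun_prop) (by fun_prop)]
  simp [Function.comp_def]

theorem IndepSequences.comp_left {Ω S₁ S₂ S₃ S : Type*} [MeasurableSpace Ω] [MeasurableSpace S₁]
    [MeasurableSpace S₂] [MeasurableSpace S₃] [MeasurableSpace S] {A : ℕ → Ω → S₁}
    {B : ℕ → Ω → S₂} {C : ℕ → Ω → S₃} {P : Measure Ω} (h : IndepSequences A B C P) {f : S₁ → S}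
    (hf : Measurable f) : IndepSequences (fun i ω => f (A i ω)) B C P where
  indep_left := h.indep_left.comp
    (measurable_pi_lambda (fun (a : ℕ → S₁) i => f (a i)) fun i => by fun_prop) measurable_id
  indep_right := h.indep_right

theorem theorem2 {Ω : Type*} [MeasurableSpace Ω] (P : Measure Ω) [IsProbabilityMeasure P]
    {d : ℕ} (α : ℝ) (hα : 0 < α)
    (ν : Measure (EuclideanSpace ℝ (Fin d))) [IsFiniteMeasure ν] (hν0 : ν ≠ 0)
    (hν : IsBackgroundMeasure α ν)
    (γ : EuclideanSpace ℝ (Fin d)) (T : ℝ) (hT : 0 < T)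
    (E V : ℕ → Ω → ℝ) (Y : ℕ → Ω → EuclideanSpace ℝ (Fin d))
    (hE : IsIID E (expMeasure 1) P) (hV : IsIID V uniformUnit P)
    (hY : IsIID Y ((ν univ)⁻¹ • ν) P) (hEVY : IndepSequences E V Y P) :
    -- convergence, the Lévy property and the one-dimensional distributions
    (ShotUniformlyConverges T γ (expWeight α T (ν.real univ) E) V Y P ∧
      IsLevyProcessOn T (shotNoise T γ (expWeight α T (ν.real univ) E) V Y) P ∧
      ∀ t ∈ Icc 0 T, IsLStar α (ENNReal.ofReal t • ν) (t • γ)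
        (P.map (shotNoise T γ (expWeight α T (ν.real univ) E) V Y t))) ∧
    -- for `α = 1` the series is the one with weights `(U_1 ⋯ U_i)^{1/(T θ)}`, `U_i = exp (-E_i)`
    (α = 1 →
      IsIID (fun i ω => Real.exp (-E i ω)) uniformUnit P ∧
      IndepSequences (fun i ω => Real.exp (-E i ω)) V Y P ∧
      ∀ᵐ ω ∂P, ∀ t ∈ Icc 0 T,
        shotNoise T γ (expWeight α T (ν.real univ) E) V Y t ω =
          shotNoise T γ (prodWeight T (ν.real univ) (fun i ω => Real.exp (-E i ω))) V Y t ω) ∧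
    -- for `α = 1` any iid `U(0,1)` sequence independent of `V` and `Y` may be used
    (α = 1 → ∀ U : ℕ → Ω → ℝ, IsIID U uniformUnit P → IndepSequences U V Y P →
      ShotUniformlyConverges T γ (prodWeight T (ν.real univ) U) V Y P ∧
      IsLevyProcessOn T (shotNoise T γ (prodWeight T (ν.real univ) U) V Y) P ∧
      ∀ t ∈ Icc 0 T, IsLStar α (ENNReal.ofReal t • ν) (t • γ)
        (P.map (shotNoise T γ (prodWeight T (ν.real univ) U) V Y t))) := by
  have : NeZero ν := ⟨hν0⟩
  -- Weights are only required to agree almost surely: for given uniform `U`, the identity `U_i =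
  -- exp(log U_i)` is available only where `U_i > 0`.
  have main : ∀ E W : ℕ → Ω → ℝ, IsIID E (expMeasure 1) P → IndepSequences E V Y P →
      (∀ᵐ ω ∂P, ∀ i, W i ω = expWeight α T (ν.real univ) E i ω) →
      ShotUniformlyConverges T γ W V Y P ∧ IsLevyProcessOn T (shotNoise T γ W V Y) P ∧
      ∀ t ∈ Icc 0 T, IsLStar α (ENNReal.ofReal t • ν) (t • γ)
        (P.map (shotNoise T γ W V Y t)) := fun E W hE hEVY hW => by
    have h := isShotNoiseModel_of_ae_eq hα hν0 hν hT hE hV hY hEVY hW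
    exact ⟨h.shotUniformlyConverges T γ, h.isLevyProcessOn hT γ,
      fun t ht => h.isLStar_map_shotNoise hν0 hν hT γ ht⟩
  refine ⟨main E _ hE hEVY (ae_of_all _ fun _ _ => rfl), ?_, ?_⟩
  · rintro rfl
    have hU := hE.comp (f := fun u => Real.exp (-u)) (by fun_prop)
    rw [map_exp_neg_expMeasure_one] at hU
    refine ⟨hU, hEVY.comp_left (f := fun u => Real.exp (-u)) (by fun_prop),
      ae_of_all _ fun ω t _ => ?_⟩
    have : expWeight 1 T (ν.real univ) E =
        prodWeight T (ν.real univ) fun i ω => Real.exp (-E i ω) := by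
      ext i ω
      exact expWeight_one_eq_prodWeight T _ E i ω
    rw [this]
  · rintro rfl U hU hUVY
    have hE' := hU.comp (f := fun r => -Real.log r) (by fun_prop)
    rw [map_neg_log_uniformUnit] at hE'
    refine main _ _ hE' (hUVY.comp_left (f := fun r => -Real.log r) (by fun_prop)) ?_
    have hpos : ∀ᵐ ω ∂P, ∀ i, 0 < U i ω := ae_all_iff.2 fun i => by
      refine ae_of_ae_map (p := fun r => 0 < r) (hU.measurable i).aemeasurable ?_
      rw [hU.map_eq]
      filter_upwards [ae_restrict_mem measurableSet_Ioo] with r hr using hr.1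
    filter_upwards [hpos] with ω hω i
    rw [expWeight_one_eq_prodWeight]
    simp [prodWeight, Real.exp_log (hω _)]
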